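/- Setting. Let $\phi$ be a finite reduced crystallographic root system with coroots $\phi^\vee$, with roots and coroots in two real vector spaces in perfect duality $\langle\cdot,\cdot\rangle$ (for instance the one obtained from a reduced root datum $(X,\phi,X^\vee,\phi^\vee)$ by extending scalars to $\mathbb R$); fix simple roots and let $\phi^+$ be the positive roots. Let $\mathbb A$ be the space containing the coroots, with the hyperplanes $H_{(\alpha,n)}=\{x:\langle x,\alpha\rangle=n\}$ for $\alpha\in\phi^+$, $n\in\mathbb Z$, and the reflections $s_{(\alpha,n)}$ at them. A face of $\mathbb A$ is a non-empty intersection containing, for every $(\alpha,n)$, exactly one of $H_{(\alpha,n)}$ and its two closed half-spaces as a factor; vertices and edges are the faces of dimension $0$ and $1$. Fix a vertex $V$. A 2-step gallery $(E\supset V\subset F)$ consists of edges $E,F$ containing $V$. It is minimal if $F\subset V+C$ and $E\subset V-C$ for some closed Weyl chamber $C$ of the linear arrangement of all $H_{(\alpha,0)}$. Residue at $V$. The residue $\mathbb A_V$ is $\mathbb A$ with only the hyperplanes $H_{(\alpha,n)}$ containing $V$. Its faces are the intersections $\bigcap_{H\ni V}H^{e_H}$, where each $H^{e_H}$ is $H$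 or one of its closed half-spaces, and its chambers are its full-dimensional faces. Let $C_V^-=\{x:\langle x-V,\alpha\rangle\le 0$ for all $\alpha\in\phi^+$ with $\langle V,\alpha\rangle\in\mathbb Z\}$ be the anti-dominant chamber. Let $W_V^a$ be the group generated by the reflections at the hyperplanes through $V$, with simple reflections $s_1,\dots,s_m$ at the hyperplanes $H_1,\dots,H_m$ through $V$ that belong to the simple roots of $\phi_V=\{\alpha\in\phi:\langle V,\alpha\rangle\in\mathbb Z\}$ lying in $\phi^+$, and with length function $l$. The type of a face $F\ni V$ is the set of all $j$ such that $H_j$ contains the face of $C_V^-$ that is $W_V^a$-conjugate to $F$. Let $w_F\in W_V^a$ be the shortest element sending this face of $C_V^-$ to $F$, and put $l(F)=l(w_F)$. For a chamber $S$ of $\mathbb A_V$ let $w_S\in W_V^a$ be the element with $w_S(C_V^-)=S$. A hyperplane $H$ separates a set $\Omega$ from a face $G$ if $\Omega$ lies in one closed half-space of $H$ and the relative interior of $G$ in the opposite open one. Positively folded 2-step galleries. $(E\supset V\subset F)$ is obtained from $(E\supset V\subset F')$ by a positive folding if $F=s_{(\alpha,n)}(F')$ for some $H_{(\alpha,n)}\ni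 V$ that separates $C_V^-\cup F'$ from $F$. It is positively folded if it is obtained from a minimal 2-step gallery by a finite (possibly empty) sequence of positive foldings. For a pair $\mathbf k=(k_1,k_2)$ of types let $\Gamma^+(\mathbf k)$ be the set of the positively folded 2-step galleries $(E\supset V\subset F)$ at $V$ with $E$ of type $k_1$ and $F$ of type $k_2$; such a gallery is said to be of type $\mathbf k$. Galleries of chambers. A gallery of chambers of type $\mathbf i=(i_1,\dots,i_l)$ is a sequence $(C_0,\dots,C_l)$ of chambers of $\mathbb A_V$ such that for each $m\ge1$ some codimension one face of $\mathbb A_V$ of type $\{i_m\}$ is contained in both $C_{m-1}$ and $C_m$. It is positively folded with respect to a chamber $S$ if, whenever $C_{m-1}=C_m$, the hyperplane spanned by the codimension one face of $C_m$ of type $\{i_m\}$ separates $S$ from $C_m$. For a 2-step gallery $(E\supset V\subset F)$, a chamber $S\supset E$ and a reduced expression $w_F=s_{i_1}\cdots s_{i_l}$, let $\Gamma^+_S((E\supset V\subset F),\mathbf i)$ be the set of galleries of chambers $(C_V^-,C_1,\dots,C_l)$ of type $\mathbf i$ that are positively folded with respect to $S$ and such that the edge $F'\ni V$ contained in $C_l$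 with the same type as $F$ makes $(E\supset V\subset F')$ minimal. Let $\Gamma^+_S((E\supset V\subset F))$ be the disjoint union of these sets over all reduced expressions of $w_F$. The two maps. Let $(E\supset V\subset F)$ be positively folded, $S\supset E$ a chamber, and $s_j$ a simple reflection with $l(s_j(F))=l(F)+1$. Define $$f_1^j:\Gamma^+_S((E\supset V\subset F),\mathbf i)\to\Gamma^+_{s_j(S)}((s_j(E)\supset V\subset s_j(F)),(j,\mathbf i)),\quad (C_V^-,C_1,\dots,C_r)\mapsto(C_V^-,s_j(C_V^-),s_j(C_1),\dots,s_j(C_r)),$$ and, if moreover $l(s_jw_S)=l(w_S)-1$, $$f_2^j:\Gamma^+_S((E\supset V\subset F),\mathbf i)\to\Gamma^+_S((E\supset V\subset s_j(F)),(j,\mathbf i)),\quad (C_V^-,C_1,\dots,C_r)\mapsto(C_V^-,C_V^-,C_1,\dots,C_r).$$ Theorem. Let $(E\supset V\subset F)$ be a positively folded 2-step gallery of type $\mathbf k$, $S_V\supset E$ a chamber of $\mathbb A_V$, and $\mathbf c\in\Gamma^+_{S_V}((E\supset V\subset F))$ of type $\mathbf i=(i_1,\dots,i_l)$. Then there exist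 a unique $(E'\supset V\subset F')\in\Gamma^+(\mathbf k)$ with $F'\subset C_V^-$, a unique chamber $S'_V\supset E'$ of $\mathbb A_V$ and a unique sequence $(p_1,\dots,p_l)\in\{1,2\}^l$ such that $\mathbf c_0=(C_V^-)$ lies in $\Gamma^+_{S'_V}((E'\supset V\subset F'))$ and $$\mathbf c=f_{p_1}^{i_1}(f_{p_2}^{i_2}(\cdots f_{p_l}^{i_l}(\mathbf c_0)\cdots)),$$ where every map is applied to an element of its domain and the equality holds in $\Gamma^+_{S_V}((E\supset V\subset F),\mathbf i)$, that is, the composition of the maps leads from $(E'\supset V\subset F')$, $S'_V$ to $(E\supset V\subset F)$, $S_V$. -/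

import Mathlib

/-!
The apartment is a finite-dimensional real vector space `N` (the real span of the coweights), with
the affine hyperplanes `⟨x, α⟩ = n` for a positive root `α` and an integer `n`. A pair `(α, n)` is
encoded as `h : ι × ℤ`, with `ι` the index type of the roots.
-/

noncomputable section

namespace OneSkeleton

variable {ι M N : Type*} [AddCommGroup M] [Module ℝ M] [AddCommGroup N] [Module ℝ N]

/-- The affine function `x ↦ ⟨x, α⟩ - n` of `h = (α, n)`. -/
def val (P : RootPairing ι ℝ M N) (h : ι × ℤ) (x : N) : ℝ := P.root' h.1 x - (h.2 : ℝ)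

/-- The affine hyperplane `H_(α,n)`. -/
def hyperplane (P : RootPairing ι ℝ M N) (h : ι × ℤ) : Set N := {x | val P h x = 0}

/-- The closed half-space of `h` with the given sign; the sign `0` gives the hyperplane itself. -/
def halfSpace (P : RootPairing ι ℝ M N) (h : ι × ℤ) : SignType → Set N
  | .pos => {x | 0 ≤ val P h x}
  | .neg => {x | val P h x ≤ 0}
  | .zero => hyperplane P h

/-- The affine reflection `s_(α,n)`, `x ↦ x - (⟨x, α⟩ - n) α^∨`. -/
def affRefl (P : RootPairing ι ℝ M N) (h : ι × ℤ) : N ≃ᵃ[ℝ] N :=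
  (P.coreflection h.1).toAffineEquiv.trans (AffineEquiv.constVAdd ℝ N ((h.2 : ℝ) • P.coroot h.1))

theorem affRefl_apply (P : RootPairing ι ℝ M N) (h : ι × ℤ) (x : N) :
    affRefl P h x = x - val P h x • P.coroot h.1 := by
  simp only [affRefl, val, AffineEquiv.trans_apply, LinearEquiv.coe_toAffineEquiv,
    AffineEquiv.constVAdd_apply, RootPairing.coreflection_apply, vadd_eq_add, sub_smul]
  abel

/-- The dimension of the affine span of a set. -/
def dim (F : Set N) : ℕ := Module.finrank ℝ (vectorSpan ℝ F)

/-! ### Faces of the apartment -/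

/-- Faces of the apartment of the affine building. -/
def IsFace {P : RootPairing ι ℝ M N} (b : P.Base) (F : Set N) : Prop :=
  F.Nonempty ∧ ∃ e : ι × ℤ → SignType, F = {x | ∀ h : ι × ℤ, b.IsPos h.1 → x ∈ halfSpace P h (e h)}

/-- Vertices (as points). -/
def IsVertex {P : RootPairing ι ℝ M N} (b : P.Base) (V : N) : Prop := IsFace b {V}

/-- Edges. -/
def IsEdge {P : RootPairing ι ℝ M N} (b : P.Base) (F : Set N) : Prop := IsFace b F ∧ dim F = 1

/-- Two-step one-skeleton galleries `(E ⊃ V ⊂ F)`. -/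
structure IsTwoStep {P : RootPairing ι ℝ M N} (b : P.Base) (V : N) (E F : Set N) : Prop where
  vertex : IsVertex b V
  edge_left : IsEdge b E
  mem_left : V ∈ E
  edge_right : IsEdge b F
  mem_right : V ∈ F

/-- Closed Weyl chambers of the linear arrangement of all `H_(α,0)`: the chamber of a
regular point `y`. -/
def IsWeylChamber (P : RootPairing ι ℝ M N) (C : Set N) : Prop :=
  ∃ y : N, (∀ i, P.root' i y ≠ 0) ∧ C = {x | ∀ i, 0 ≤ P.root' i x * P.root' i y}

/-- `(E ⊃ V ⊂ F)` is minimal: for some Weyl chamber `C` the sector `V + C` contains `F` and the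
opposite sector `V - C` contains `E`. -/
def IsMinimal {P : RootPairing ι ℝ M N} (b : P.Base) (V : N) (E F : Set N) : Prop :=
  IsTwoStep b V E F ∧
    ∃ C, IsWeylChamber P C ∧ F ⊆ (fun c => V + c) '' C ∧ E ⊆ (fun c => V - c) '' C

/-! ### The apartment of the residue at `V` -/

/-- The hyperplanes (with positive root) that contain `V`. -/
def walls {P : RootPairing ι ℝ M N} (b : P.Base) (V : N) : Set (ι × ℤ) :=
  {h | b.IsPos h.1 ∧ V ∈ hyperplane P h}

/-- The faces of the residue at `V`, in the form of closed cones based at `V`. -/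
def IsResidueFace {P : RootPairing ι ℝ M N} (b : P.Base) (V : N) (F : Set N) : Prop :=
  ∃ e : ι × ℤ → SignType, F = {x | ∀ h ∈ walls b V, x ∈ halfSpace P h (e h)}

/-- The chambers of the residue at `V`: faces that contain a point on none of its hyperplanes. -/
def IsChamber {P : RootPairing ι ℝ M N} (b : P.Base) (V : N) (C : Set N) : Prop :=
  IsResidueFace b V C ∧ ∃ y ∈ C, ∀ h ∈ walls b V, y ∉ hyperplane P h

/-- The codimension one faces of the residue at `V`. -/
def IsPanel {P : RootPairing ι ℝ M N} (b : P.Base) (V : N) (H : Set N) : Prop :=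
  IsResidueFace b V H ∧ dim H + 1 = Module.finrank ℝ N

/-- The anti-dominant chamber `C_V^-`. -/
def antiDominant {P : RootPairing ι ℝ M N} (b : P.Base) (V : N) : Set N :=
  {x | ∀ h ∈ walls b V, val P h x ≤ 0}

/-- The open face of `F` in the residue at `V`: the points of `F` lying on no other hyperplanes
through `V` than those that contain `F`. -/
def openFace {P : RootPairing ι ℝ M N} (b : P.Base) (V : N) (F : Set N) : Set N :=
  {x ∈ F | ∀ h ∈ walls b V, x ∈ hyperplane P h → F ⊆ hyperplane P h}

/-- The hyperplane `h` through `V` separates `Ω` from the face `F`: the set `Ω` lies in one of the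
closed half-spaces and the open face of `F` in the opposite open half-space. -/
def Separates {P : RootPairing ι ℝ M N} (b : P.Base) (V : N) (h : ι × ℤ) (Ω F : Set N) : Prop :=
  (Ω ⊆ {x | 0 ≤ val P h x} ∧ openFace b V F ⊆ {x | val P h x < 0}) ∨
  (Ω ⊆ {x | val P h x ≤ 0} ∧ openFace b V F ⊆ {x | 0 < val P h x})

/-- The Weyl group `W_V^a` of the residue at `V`, generated by the reflections at the hyperplanes
through `V` (it is the stabilizer of `V` in the affine Weyl group). -/
def weyl {P : RootPairing ι ℝ M N} (b : P.Base) (V : N) : Subgroup (N ≃ᵃ[ℝ] N) :=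
  Subgroup.closure (affRefl P '' walls b V)

/-- The pairs `(β, n)` with `β` a simple root of the root system `φ_V` (a positive root of `φ_V`
that is not a sum of two positive roots of `φ_V`) and `V ∈ H_(β,n)`. They index the simple
reflections of `W_V^a`. -/
def Simple {P : RootPairing ι ℝ M N} (b : P.Base) (V : N) : Type _ :=
  {h : ι × ℤ // h ∈ walls b V ∧
    ¬ ∃ h₁ ∈ walls b V, ∃ h₂ ∈ walls b V, P.root h.1 = P.root h₁.1 + P.root h₂.1}

/-- The simple reflection `s_j` of `W_V^a`. -/
def simpleRefl {P : RootPairing ι ℝ M N} {b : P.Base} {V : N} (j : Simple b V) : N ≃ᵃ[ℝ] N :=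
  affRefl P j.1

/-- The product `s_{i₁} ⋯ s_{i_l}` of a word of simple reflections. -/
def wordProd {P : RootPairing ι ℝ M N} {b : P.Base} {V : N} (i : List (Simple b V)) : N ≃ᵃ[ℝ] N :=
  (i.map simpleRefl).prod

/-- The length function of `W_V^a` with respect to the simple reflections. -/
def len {P : RootPairing ι ℝ M N} (b : P.Base) (V : N) (w : N ≃ᵃ[ℝ] N) : ℕ :=
  sInf {k | ∃ i : List (Simple b V), wordProd i = w ∧ i.length = k}

/-- `i` is a reduced expression of `w`. -/
def IsReducedExpr {P : RootPairing ι ℝ M N} {b : P.Base} {V : N} (i : List (Simple b V))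
    (w : N ≃ᵃ[ℝ] N) : Prop :=
  wordProd i = w ∧ i.length = len b V w

/-- The type, in the residue at `V`, of a face `F` with `V ∈ F`: the simple hyperplanes
containing the face of `C_V^-` that is conjugate to `F` under `W_V^a`. -/
def faceType {P : RootPairing ι ℝ M N} (b : P.Base) (V : N) (F : Set N) : Set (Simple b V) :=
  {j | ∃ w ∈ weyl b V, ∃ F₀ ⊆ antiDominant b V, w '' F₀ = F ∧ F₀ ⊆ hyperplane P j.1}

/-- `w ∈ W_V^a` sends the face of `C_V^-` with the type of `F` to `F`. -/
def SendsTo {P : RootPairing ι ℝ M N} (b : P.Base) (V : N) (F : Set N) (w : N ≃ᵃ[ℝ] N) : Prop :=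
  w ∈ weyl b V ∧ ∃ F₀ ⊆ antiDominant b V, faceType b V F₀ = faceType b V F ∧ w '' F₀ = F

/-- `w = w_F`, the element of minimal length sending the face of `C_V^-` with the type of `F`
to `F`. -/
def IsMinElt {P : RootPairing ι ℝ M N} (b : P.Base) (V : N) (F : Set N) (w : N ≃ᵃ[ℝ] N) : Prop :=
  SendsTo b V F w ∧ ∀ w', SendsTo b V F w' → len b V w ≤ len b V w'

/-- The length `l(F)` of a face. -/
def faceLen {P : RootPairing ι ℝ M N} (b : P.Base) (V : N) (F : Set N) : ℕ :=
  sInf {k | ∃ w, IsMinElt b V F w ∧ len b V w = k}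

/-! ### Positively folded two-step galleries -/

/-- `(E ⊃ V ⊂ F)` is obtained from `(E ⊃ V ⊂ F')` by a positive folding. -/
def IsPosFolding {P : RootPairing ι ℝ M N} (b : P.Base) (V : N) (F' F : Set N) : Prop :=
  ∃ h ∈ walls b V, affRefl P h '' F' = F ∧ Separates b V h (antiDominant b V ∪ F') F

/-- Positively folded two-step galleries: a chain (possibly of length zero) of positive foldings
leads from a minimal one to the given one. -/
def IsPosFolded {P : RootPairing ι ℝ M N} (b : P.Base) (V : N) (E F : Set N) : Prop :=
  IsTwoStep b V E F ∧ ∃ F₀, IsMinimal b V E F₀ ∧ Relation.ReflTransGen (IsPosFolding b V) F₀ F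

/-- The set `Γ⁺(k)` of the positively folded two-step galleries at `V` of type `k = (k₁, k₂)`. -/
def GammaType {P : RootPairing ι ℝ M N} (b : P.Base) (V : N)
    (k : Set (Simple b V) × Set (Simple b V)) : Set (Set N × Set N) :=
  {g | IsPosFolded b V g.1 g.2 ∧ faceType b V g.1 = k.1 ∧ faceType b V g.2 = k.2}

/-! ### Galleries of chambers -/

/-- `gal = (C_0, …, C_l)` is a gallery of chambers of type `i = (i_1, …, i_l)` in the residue
at `V`. -/
structure IsGallery {P : RootPairing ι ℝ M N} (b : P.Base) (V : N) (i : List (Simple b V))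
    (gal : List (Set N)) : Prop where
  length_eq : gal.length = i.length + 1
  chamber : ∀ C ∈ gal, IsChamber b V C
  panel : ∀ (m : ℕ) (hm : m < i.length), ∃ H, IsPanel b V H ∧ faceType b V H = {i[m]} ∧
    H ⊆ gal[m] ∧ H ⊆ gal[m + 1]

/-- All foldings `C_m = C_{m+1}` of `gal` are positive with respect to `S`: the hyperplane spanned
by the face of type `i_{m+1}` of `C_m` separates `S` from `C_m`. -/
def IsPosFoldedGallery {P : RootPairing ι ℝ M N} (b : P.Base) (V : N) (S : Set N)
    (i : List (Simple b V)) (gal : List (Set N)) : Prop :=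
  ∀ (m : ℕ) (hm : m < i.length) (hc : m + 1 < gal.length), gal[m] = gal[m + 1] →
    ∃ H, IsPanel b V H ∧ faceType b V H = {i[m]} ∧ H ⊆ gal[m] ∧
      ∃ h ∈ walls b V, H ⊆ hyperplane P h ∧ Separates b V h S gal[m]

/-- The set `Γ⁺_S((E ⊃ V ⊂ F))`, the disjoint union over the reduced expressions `i` of `w_F` of
the sets `Γ⁺_S((E ⊃ V ⊂ F), i)`; its elements are the pairs `(i, gal)` of a type and a sequence of
chambers. -/
structure MemGamma {P : RootPairing ι ℝ M N} (b : P.Base) (V : N) (E F S : Set N)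
    (i : List (Simple b V)) (gal : List (Set N)) : Prop where
  chamber : IsChamber b V S
  subset : E ⊆ S
  reduced : ∃ w, IsMinElt b V F w ∧ IsReducedExpr i w
  gallery : IsGallery b V i gal
  head : gal.head? = some (antiDominant b V)
  folded : IsPosFoldedGallery b V S i gal
  last : ∃ C F', gal.getLast? = some C ∧ F' ⊆ C ∧ faceType b V F' = faceType b V F ∧
    IsMinimal b V E F'

/-! ### The two constructions and their iteration -/

/-- A gallery of chambers together with the set `Γ⁺_S((E ⊃ V ⊂ F), i)` in which it is regarded. -/
@[ext] structure TaggedGallery {P : RootPairing ι ℝ M N} (b : P.Base) (V : N) where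
  E : Set N
  F : Set N
  S : Set N
  type : List (Simple b V)
  chambers : List (Set N)

/-- The indices of the two constructions `f_1^j` and `f_2^j`. -/
inductive Kind
  | one
  | two

/-- The maps `f_1^j` (reflect and cross) and `f_2^j` (fold), with their effect on the sets
`Γ⁺_S((E ⊃ V ⊂ F), i)`. -/
def f {P : RootPairing ι ℝ M N} {b : P.Base} {V : N} (p : Kind) (j : Simple b V)
    (x : TaggedGallery b V) : TaggedGallery b V :=
  match p with
  | .one =>
    { E := simpleRefl j '' x.E
      F := simpleRefl j '' x.F
      S := simpleRefl j '' x.S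
      type := j :: x.type
      chambers := antiDominant b V :: x.chambers.map (fun C => simpleRefl j '' C) }
  | .two =>
    { E := x.E
      F := simpleRefl j '' x.F
      S := x.S
      type := j :: x.type
      chambers := antiDominant b V :: x.chambers }

/-- The domains of `f_1^j` and `f_2^j`: galleries in some `Γ⁺_S((E ⊃ V ⊂ F), i)` with
`(E ⊃ V ⊂ F)` positively folded and `l(s_j(F)) = l(F) + 1`; for `f_2^j` moreover
`l(s_j w_S) = l(w_S) - 1`, where `w_S ∈ W_V^a` sends `C_V^-` to `S`. -/
def Dom {P : RootPairing ι ℝ M N} {b : P.Base} {V : N} (p : Kind) (j : Simple b V)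
    (x : TaggedGallery b V) : Prop :=
  IsPosFolded b V x.E x.F ∧ MemGamma b V x.E x.F x.S x.type x.chambers ∧
  faceLen b V (simpleRefl j '' x.F) = faceLen b V x.F + 1 ∧
  match p with
  | .one => True
  | .two => ∃ w ∈ weyl b V, w '' antiDominant b V = x.S ∧
      len b V (simpleRefl j * w) + 1 = len b V w

/-- `y = f_{p_1}^{j_1}(f_{p_2}^{j_2}(⋯ f_{p_l}^{j_l}(x) ⋯))`, all the maps being applied to
elements of their domains. -/
def IsIterate {P : RootPairing ι ℝ M N} {b : P.Base} {V : N} (x : TaggedGallery b V) :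
    List Kind → List (Simple b V) → TaggedGallery b V → Prop
  | [], [], y => y = x
  | p :: ps, j :: js, y => ∃ z, IsIterate x ps js z ∧ Dom p j z ∧ y = f p j z
  | _, _, _ => False

end OneSkeleton

end

/-! A gallery of chambers is peeled one letter at a time. If `c = (C_V^-, C_1, …)` has type `(j,
i)`, then `C_V^-` and `C_1` share a panel of type `j`, so `C_1` is `C_V^-` or `s_j(C_V^-)`
(`chamber_eq_or_eq`). In the second case, dropping the first chamber and reflecting everything by
`s_j` exhibits `c` as a value of `f_1^j`. In the first case, dropping it exhibits `c` as a value of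
`f_2^j`, and positivity of the fold says that `H_j` separates `S` from `C_V^-`, that is, `l(s_j w_S)
= l(w_S) - 1`. As `(j, i)` is a reduced word of `w_F`, the word `i` is one of `w_{s_j(F)} = s_j
w_F`. When the word is empty, `w_F = 1` and `F ⊂ C_V^-`. The two cases exclude each other and `s_j`
acts injectively on sets, so every backward step is forced (`f_injective`); this is uniqueness.

The domains of the maps also require the intermediate 2-step galleries to be positively folded. This
follows from the gallery of chambers alone: `IsGallery.reflTransGen` builds a chain of positive
foldings from the edge `F'` in the last chamber to `F`. Each letter offers the fold `s_j(F) → F`,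
and a crossing is handled by an analogue of the lifting property of the Bruhat order
(`reflTransGen_image_or`).

Underneath lies the Coxeter theory of `W_V^a`: `s_j` permutes the positive roots of `φ_V` other than
its own (`reflIdx_mem_walls`), whence the exchange condition (`exchange`) and the strict fundamental
domain (`eq_of_mem_antiDominant`). The chain starts correctly because an edge in `C_V^-` is
determined by its type (`IsEdge.eq_of_faceType_eq`); there the full affine arrangement enters, since
edges are its faces and not those of the residue. -/

noncomputable section

namespace OneSkeleton

variable {ι M N : Type*} [AddCommGroup M] [Module ℝ M] [AddCommGroup N] [Module ℝ N]

/-! ### Affine roots -/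

section AffineRoots

variable (P : RootPairing ι ℝ M N)

/-- The affine root `-h`. -/
def negIdx (h : ι × ℤ) : ι × ℤ := (P.reflectionPerm h.1 h.1, -h.2)

theorem root'_reflectionPerm (i j : ι) (x : N) :
    P.root' (P.reflectionPerm i j) x = P.root' j x - P.pairing j i * P.root' i x := by
  simp [RootPairing.root', RootPairing.root_reflectionPerm, RootPairing.reflection_apply_root]

theorem val_negIdx (h : ι × ℤ) (x : N) : val P (negIdx P h) x = -val P h x := by
  simp only [val, negIdx, root'_reflectionPerm, RootPairing.pairing_same]
  push_cast; ring

theorem val_injective {h k : ι × ℤ} (H : ∀ x, val P h x = val P k x) : h = k := by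
  have h0 := H 0
  simp only [val, map_zero, zero_sub, neg_inj, Int.cast_inj] at h0
  have h1 : P.root' h.1 = P.root' k.1 := by
    ext x
    have := H x
    simpa [val, h0] using this
  refine Prod.ext ?_ h0
  apply P.root.injective
  apply P.toPerfPair.injective
  ext x
  exact DFunLike.congr_fun h1 x

theorem negIdx_negIdx (h : ι × ℤ) : negIdx P (negIdx P h) = h :=
  val_injective P fun x => by simp [val_negIdx]

theorem val_affine (h : ι × ℤ) (x d : N) : val P h (x + d) = val P h x + P.root' h.1 d := by
  simp [val]; ring

theorem val_affRefl_self (h : ι × ℤ) (x : N) : val P h (affRefl P h x) = -val P h x := by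
  rw [affRefl_apply, sub_eq_add_neg, val_affine]
  simp; ring

theorem affRefl_affRefl (h : ι × ℤ) (x : N) : affRefl P h (affRefl P h x) = x := by
  rw [affRefl_apply, val_affRefl_self, affRefl_apply]; simp

theorem affRefl_mul_self (h : ι × ℤ) : affRefl P h * affRefl P h = 1 := by
  ext x; exact affRefl_affRefl P h x

theorem affRefl_inv (h : ι × ℤ) : (affRefl P h)⁻¹ = affRefl P h :=
  inv_eq_of_mul_eq_one_left (affRefl_mul_self P h)

theorem affRefl_of_val_eq_zero {h : ι × ℤ} {x : N} (hx : val P h x = 0) : affRefl P h x = x := by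
  rw [affRefl_apply, hx]; simp

variable [P.IsCrystallographic]

/-- The affine root `k ∘ s_h`. -/
def reflIdx (h k : ι × ℤ) : ι × ℤ :=
  (P.reflectionPerm h.1 k.1, k.2 - h.2 * P.pairingIn ℤ k.1 h.1)

/-- Integrality of the Cartan numbers is what keeps the constant term of `k ∘ s_h` an integer, so
that affine roots are permuted. -/
theorem val_reflIdx (h k : ι × ℤ) (x : N) : val P (reflIdx P h k) x = val P k (affRefl P h x) := by
  have hp : ((P.pairingIn ℤ k.1 h.1 : ℤ) : ℝ) = P.pairing k.1 h.1 := P.algebraMap_pairingIn ℤ k.1 h.1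
  rw [affRefl_apply, sub_eq_add_neg, val_affine]
  simp only [val, reflIdx, root'_reflectionPerm, map_neg, map_smul,
    RootPairing.root'_coroot_eq_pairing, smul_eq_mul]
  push_cast
  rw [hp]; ring

theorem reflIdx_involutive (h : ι × ℤ) : Function.Involutive (reflIdx P h) := fun k =>
  val_injective P fun x => by rw [val_reflIdx, val_reflIdx, affRefl_affRefl]

theorem affRefl_mul_affRefl_reflIdx (h k : ι × ℤ) :
    affRefl P h * affRefl P (reflIdx P h k) = affRefl P k * affRefl P h := by
  ext x
  simp only [AffineEquiv.mul_def, AffineEquiv.trans_apply]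
  rw [affRefl_apply P (reflIdx P h k), val_reflIdx, affRefl_apply P k, sub_eq_add_neg,
    affRefl_apply P h (_ + _), val_affine]
  generalize val P k (affRefl P h x) = t
  rw [affRefl_apply P h x]
  simp only [reflIdx, RootPairing.coroot_reflectionPerm, RootPairing.coreflection_apply, map_neg,
    map_smul, map_sub, smul_eq_mul]
  simp only [RootPairing.root', RootPairing.root_coroot_eq_pairing,
    RootPairing.pairing_same]
  module

end AffineRoots

/-! ### Walls and simple roots -/

section Walls

variable {P : RootPairing ι ℝ M N} (b : P.Base) (V : N)

theorem isPos_or_isPos_negIdx (h : ι × ℤ) : b.IsPos h.1 ∨ b.IsPos (negIdx P h).1 :=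
  RootPairing.Base.IsPos.or_neg b h.1

variable {b V}

theorem val_vertex {h : ι × ℤ} (hh : h ∈ walls b V) : val P h V = 0 := hh.2

theorem mem_walls_or {h : ι × ℤ} (hh : val P h V = 0) :
    h ∈ walls b V ∨ negIdx P h ∈ walls b V := by
  rcases isPos_or_isPos_negIdx b h with h1 | h1
  · exact .inl ⟨h1, hh⟩
  · exact .inr ⟨h1, by simp [hyperplane, val_negIdx, hh]⟩

theorem wall_ext {h k : ι × ℤ} (hh : h ∈ walls b V) (hk : k ∈ walls b V) (e : h.1 = k.1) :
    h = k := by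
  refine Prod.ext e ?_
  have h1 := val_vertex hh
  have h2 := val_vertex hk
  simp only [val, e] at h1 h2
  have : (h.2 : ℝ) = k.2 := by linarith
  exact_mod_cast this

theorem val_eq_root' {h : ι × ℤ} (hh : h ∈ walls b V) (x : N) :
    val P h x = P.root' h.1 (x - V) := by
  have := val_affine P h V (x - V)
  rwa [val_vertex hh, zero_add, add_sub_cancel] at this

theorem val_add {h h₁ h₂ : ι × ℤ} (hh : h ∈ walls b V) (hh₁ : h₁ ∈ walls b V)
    (hh₂ : h₂ ∈ walls b V) (e : P.root h.1 = P.root h₁.1 + P.root h₂.1) (x : N) :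
    val P h x = val P h₁ x + val P h₂ x := by
  rw [val_eq_root' hh, val_eq_root' hh₁, val_eq_root' hh₂]
  simp [RootPairing.root', e]

theorem walls_finite [Finite ι] : (walls b V).Finite :=
  Set.Finite.of_injOn (f := Prod.fst) (t := Set.univ) (fun _ _ => Set.mem_univ _)
    (fun _ hx _ hy e => wall_ext hx hy e) Set.finite_univ

/-- Induction on the height with respect to `b`: it is additive and positive on positive roots, so
both summands of a decomposable root of `φ_V` are strictly lower. This replaces expansions in the
simple roots of `φ_V`, which need not be simple in `φ`. -/
theorem wall_induction {p : ι × ℤ → Prop} (hs : ∀ j : Simple b V, p j.1)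
    (ha : ∀ h ∈ walls b V, ∀ h₁ ∈ walls b V, ∀ h₂ ∈ walls b V,
      P.root h.1 = P.root h₁.1 + P.root h₂.1 → p h₁ → p h₂ → p h) :
    ∀ h ∈ walls b V, p h := by
  suffices H : ∀ n : ℕ, ∀ h ∈ walls b V, b.height h.1 ≤ n → p h from fun h hh =>
    H (b.height h.1).toNat h hh (by simp)
  intro n
  induction n with
  | zero => intro h hh hn; exact absurd hh.1 (by rw [RootPairing.Base.isPos_iff]; lia)
  | succ n ih =>
    intro h hh hn
    by_cases hd : ∃ h₁ ∈ walls b V, ∃ h₂ ∈ walls b V, P.root h.1 = P.root h₁.1 + P.root h₂.1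
    · obtain ⟨h₁, hh₁, h₂, hh₂, e⟩ := hd
      have := b.height_add e
      have p1 := hh₁.1
      have p2 := hh₂.1
      rw [RootPairing.Base.isPos_iff] at p1 p2
      exact ha h hh h₁ hh₁ h₂ hh₂ e (ih _ hh₁ (by push_cast at hn; lia))
        (ih _ hh₂ (by push_cast at hn; lia))
    · exact hs ⟨h, hh, hd⟩

theorem mem_antiDominant_of_simple {x : N} (hx : ∀ j : Simple b V, val P j.1 x ≤ 0) :
    x ∈ antiDominant b V := by
  refine wall_induction hx fun h hh h₁ hh₁ h₂ hh₂ e p1 p2 => ?_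
  rw [val_add hh hh₁ hh₂ e]; linarith

theorem val_eq_zero_of_simple {x y : N} (hx : x ∈ antiDominant b V)
    (H : ∀ j : Simple b V, val P j.1 x = 0 → val P j.1 y = 0) :
    ∀ h ∈ walls b V, val P h x = 0 → val P h y = 0 := by
  refine wall_induction H fun h hh h₁ hh₁ h₂ hh₂ e p1 p2 h0 => ?_
  have l1 := hx _ hh₁
  have l2 := hx _ hh₂
  rw [val_add hh hh₁ hh₂ e] at h0 ⊢
  rw [p1 (by linarith), p2 (by linarith), add_zero]

variable (b) in
-- The simple roots are independent but need not span `M`, so they are extended to a basis before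
-- the functional with value `1` on them is chosen.
theorem exists_coweight : ∃ ρ : N, ∀ i, P.root' i ρ = (b.height i : ℝ) := by
  have hli : LinearIndependent ℝ fun i : b.support => P.root i := b.linearIndepOn_root
  let B := Module.Basis.extend hli.linearIndepOn_id
  let g : Module.Dual ℝ M := B.constr ℝ fun _ => (1 : ℝ)
  have hg : ∀ i ∈ b.support, g (P.root i) = 1 := by
    intro i hi
    have hm : P.root i ∈ hli.linearIndepOn_id.extend (Set.subset_univ _) :=
      hli.linearIndepOn_id.subset_extend _ ⟨⟨i, hi⟩, rfl⟩
    have : B ⟨P.root i, hm⟩ = P.root i := Module.Basis.extend_apply_self _ _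
    rw [← this]; exact B.constr_basis ℝ _ _
  refine ⟨P.flip.toPerfPair.symm g, fun i => ?_⟩
  have e : P.root' i (P.flip.toPerfPair.symm g) = g (P.root i) := by
    have := P.flip.toPerfPair.apply_symm_apply g
    exact DFunLike.congr_fun this (P.root i)
  rw [e]
  obtain ⟨f, hf, -, h2⟩ := b.exists_root_eq_sum_int i
  rw [b.height_eq_sum h2, h2, map_sum]
  push_cast
  refine Finset.sum_congr rfl fun j hj => ?_
  rw [map_zsmul, hg j hj]; simp

variable (b V) in
theorem exists_regular : ∃ y : N, ∀ h ∈ walls b V, val P h y < 0 := by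
  obtain ⟨ρ, hρ⟩ := exists_coweight b
  refine ⟨V - ρ, fun h hh => ?_⟩
  rw [val_eq_root' hh]
  have := hh.1
  rw [RootPairing.Base.isPos_iff] at this
  simpa [hρ] using this

variable [Finite ι] [P.IsCrystallographic]

/-- A positive pairing would make the difference a root, again integral at `V`. Whichever sign of it
is positive, one of `i` and `j` becomes a sum of two positive roots of `φ_V`. -/
theorem simple_pairing_nonpos {i j : Simple b V} (hij : i ≠ j) : P.pairing i.1.1 j.1.1 ≤ 0 := by
  by_contra! hlt
  have hp := P.algebraMap_pairingIn ℤ i.1.1 j.1.1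
  rw [← hp] at hlt
  have hne : i.1.1 ≠ j.1.1 := fun e => hij (Subtype.ext (wall_ext i.2.1 j.2.1 e))
  obtain ⟨k, hk⟩ := P.root_sub_root_mem_of_pairingIn_pos (by simpa using hlt) hne
  have hv : val P (k, i.1.2 - j.1.2) V = 0 := by
    have h1 := val_vertex i.2.1
    have h2 := val_vertex j.2.1
    simp only [val, RootPairing.root', hk, map_sub] at h1 h2 ⊢
    push_cast
    simp only [LinearMap.sub_apply]
    linarith
  rcases mem_walls_or (b := b) hv with h | h
  · exact i.2.2 ⟨_, h, j.1, j.2.1, by simp [hk]⟩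
  · exact j.2.2 ⟨_, h, i.1, i.2.1, by
      have e : P.root (negIdx P (k, i.1.2 - j.1.2)).1 = -P.root k := by
        simp [negIdx, RootPairing.root_reflectionPerm]
      rw [e, hk]; abel⟩

variable [P.IsReduced]

/-- Project a regular antidominant point onto `H_j` along the coroot of `j`. Values at other simple
roots stay negative because their pairings with `j` are nonpositive. -/
theorem exists_mem_simple_wall (j : Simple b V) :
    ∃ y : N, val P j.1 y = 0 ∧ ∀ h ∈ walls b V, h ≠ j.1 → val P h y < 0 := by
  obtain ⟨y₀, hy₀⟩ := exists_regular b V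
  have key : ∀ h, val P h (y₀ + (-(val P j.1 y₀ / 2)) • P.coroot j.1.1) =
      val P h y₀ - val P j.1 y₀ / 2 * P.pairing h.1 j.1.1 := fun h => by
    rw [val_affine, map_smul, RootPairing.root'_coroot_eq_pairing, smul_eq_mul]; ring
  refine ⟨y₀ + (-(val P j.1 y₀ / 2)) • P.coroot j.1.1, ?_, ?_⟩
  · rw [key, RootPairing.pairing_same]; ring
  generalize hy : y₀ + (-(val P j.1 y₀ / 2)) • P.coroot j.1.1 = y at key
  have hj0 : val P j.1 y = 0 := by rw [key, RootPairing.pairing_same]; ring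
  refine wall_induction (fun i hi => ?_) fun h hh h₁ hh₁ h₂ hh₂ e p1 p2 hne => ?_
  · rw [key]
    have h1 := simple_pairing_nonpos (i := i) (j := j) fun e => hi (congrArg _ e)
    have h2 := hy₀ _ j.2.1
    have h3 := hy₀ _ i.2.1
    nlinarith
  · rw [val_add hh hh₁ hh₂ e]
    by_cases e1 : h₁ = j.1
    -- Two summands equal to `j` would make twice a root a root, against reducedness; so at most one
    -- summand vanishes at `y`.
    · have e2 : h₂ ≠ j.1 := by
        rintro e2
        rw [e1, e2, ← two_smul ℝ] at e
        have hd : ¬ LinearIndependent ℝ ![P.root h.1, P.root j.1.1] := by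
          rw [e]
          intro hl
          have := LinearIndependent.pair_iff.mp hl 1 (-2) (by module)
          simp at this
        have hnz := P.ne_zero j.1.1
        rcases RootPairing.IsReduced.eq_or_eq_neg _ _ hd with h' | h' <;> rw [e] at h'
        · exact hnz (by simpa [two_smul] using h')
        · have : (3 : ℝ) • P.root j.1.1 = 0 := by
            rw [eq_neg_iff_add_eq_zero] at h'
            rw [← h']; module
          simp [hnz] at this
      rw [e1, hj0]; linarith [p2 e2]
    · have := p1 e1
      by_cases e2 : h₂ = j.1
      · rw [e2, hj0]; linarith
      · linarith [p2 e2]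

/-- At a generic point of the wall of `j`, which `s_j` fixes, the reflected root has the same
negative value as `h`, so its negative cannot be a positive root. -/
theorem reflIdx_mem_walls (j : Simple b V) {h : ι × ℤ} (hh : h ∈ walls b V) (hne : h ≠ j.1) :
    reflIdx P j.1 h ∈ walls b V := by
  obtain ⟨y, hy0, hy⟩ := exists_mem_simple_wall j
  have hv : val P (reflIdx P j.1 h) V = 0 := by
    rw [val_reflIdx, affRefl_of_val_eq_zero P (val_vertex j.2.1), val_vertex hh]
  refine (mem_walls_or (b := b) hv).resolve_right fun hn => ?_
  have h1 : val P (negIdx P (reflIdx P j.1 h)) y ≤ 0 := by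
    by_cases e : negIdx P (reflIdx P j.1 h) = j.1
    · rw [e, hy0]
    · exact (hy _ hn e).le
  rw [val_negIdx, val_reflIdx, affRefl_of_val_eq_zero P hy0] at h1
  linarith [hy h hh hne]

end Walls

/-! ### The Weyl group of the residue -/

section Weyl

variable {P : RootPairing ι ℝ M N} {b : P.Base} {V : N}

theorem wordProd_cons (j : Simple b V) (L : List (Simple b V)) :
    wordProd (j :: L) = simpleRefl j * wordProd L := by simp [wordProd]

theorem wordProd_append (L L' : List (Simple b V)) :
    wordProd (L ++ L') = wordProd L * wordProd L' := by simp [wordProd]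

theorem simpleRefl_mul_self (j : Simple b V) : simpleRefl j * simpleRefl j = 1 :=
  affRefl_mul_self P j.1

theorem simpleRefl_mul_cancel (j : Simple b V) (w : N ≃ᵃ[ℝ] N) :
    simpleRefl j * (simpleRefl j * w) = w := by
  rw [← mul_assoc, simpleRefl_mul_self, one_mul]

theorem simpleRefl_inv (j : Simple b V) : (simpleRefl j)⁻¹ = simpleRefl j := affRefl_inv P j.1

theorem affRefl_mem {h : ι × ℤ} (hh : h ∈ walls b V) : affRefl P h ∈ weyl b V :=
  Subgroup.subset_closure ⟨h, hh, rfl⟩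

theorem simpleRefl_mem (j : Simple b V) : simpleRefl j ∈ weyl b V := affRefl_mem j.2.1

theorem wordProd_mem (L : List (Simple b V)) : wordProd L ∈ weyl b V := by
  induction L with
  | nil => simp [wordProd]
  | cons j L ih => rw [wordProd_cons]; exact mul_mem (simpleRefl_mem j) ih

theorem wordProd_inv (L : List (Simple b V)) : (wordProd L)⁻¹ = wordProd L.reverse := by
  induction L with
  | nil => simp [wordProd]
  | cons j L ih =>
    rw [wordProd_cons, List.reverse_cons, wordProd_append, ← ih, mul_inv_rev, simpleRefl_inv]
    simp [wordProd]

theorem weyl_vertex {w : N ≃ᵃ[ℝ] N} (hw : w ∈ weyl b V) : w V = V := by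
  induction hw using Subgroup.closure_induction with
  | mem x hx =>
    obtain ⟨h, hh, rfl⟩ := hx
    exact affRefl_of_val_eq_zero P (val_vertex hh)
  | one => rfl
  | mul x y _ _ hx hy => rw [AffineEquiv.mul_def, AffineEquiv.trans_apply, hy, hx]
  | inv x _ hx => exact (AffineEquiv.symm_apply_eq x).mpr hx.symm

theorem len_le {L : List (Simple b V)} {w : N ≃ᵃ[ℝ] N} (h : wordProd L = w) :
    len b V w ≤ L.length :=
  Nat.sInf_le ⟨L, h, rfl⟩

theorem exists_perm_of_mem_weyl [P.IsCrystallographic] {w : N ≃ᵃ[ℝ] N} (hw : w ∈ weyl b V) :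
    ∃ σ : Equiv.Perm (ι × ℤ), ∀ h x, val P (σ h) x = val P h (w x) := by
  induction hw using Subgroup.closure_induction with
  | mem x hx =>
    obtain ⟨h, hh, rfl⟩ := hx
    exact ⟨(reflIdx_involutive P h).toPerm, fun k x => val_reflIdx P h k x⟩
  | one => exact ⟨1, fun _ _ => rfl⟩
  | mul x y _ _ hx hy =>
    obtain ⟨σ, hσ⟩ := hx
    obtain ⟨τ, hτ⟩ := hy
    refine ⟨σ.trans τ, fun h z => ?_⟩
    rw [Equiv.trans_apply, hτ, hσ]; rfl
  | inv x _ hx =>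
    obtain ⟨σ, hσ⟩ := hx
    refine ⟨σ.symm, fun h z => ?_⟩
    have := hσ (σ.symm h) (x⁻¹ z)
    rw [Equiv.apply_symm_apply] at this
    rw [this]
    congr 1
    exact (x.apply_symm_apply z).symm

variable [Finite ι] [P.IsCrystallographic] [P.IsReduced]

/-- The exchange condition: along the word, the point must cross `h` at some letter, and there the
conjugated root is the simple root of that letter, which can be deleted. -/
theorem exchange {x : N} (hx : x ∈ antiDominant b V) (L : List (Simple b V)) :
    ∀ h ∈ walls b V, 0 < val P h (wordProd L x) →
      ∃ L' : List (Simple b V), L'.length + 1 = L.length ∧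
        wordProd L' = affRefl P h * wordProd L := by
  induction L with
  | nil => intro h hh h0; exact absurd (hx h hh) (not_le.mpr h0)
  | cons k L ih =>
    intro h hh h0
    by_cases e : h = k.1
    · subst e
      exact ⟨L, rfl, by rw [wordProd_cons]; exact (simpleRefl_mul_cancel k _).symm⟩
    · obtain ⟨L', hl, hL'⟩ := ih (reflIdx P k.1 h) (reflIdx_mem_walls k hh e) (by
        rw [val_reflIdx]; rwa [wordProd_cons] at h0)
      refine ⟨k :: L', by simp [hl], ?_⟩
      rw [wordProd_cons, hL', wordProd_cons, ← mul_assoc, ← mul_assoc]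
      congr 1
      exact affRefl_mul_affRefl_reflIdx P k.1 h

theorem exists_word_mem_antiDominant (x : N) :
    ∃ L : List (Simple b V), wordProd L x ∈ antiDominant b V := by
  induction hn : {h ∈ walls b V | 0 < val P h x}.ncard using Nat.strong_induction_on
    generalizing x with
  | _ n ih =>
  by_cases hx : x ∈ antiDominant b V
  · exact ⟨[], hx⟩
  · obtain ⟨j, hj⟩ : ∃ j : Simple b V, 0 < val P j.1 x := by
      by_contra! H
      exact hx (mem_antiDominant_of_simple H)
    have hfin : {h ∈ walls b V | 0 < val P h x}.Finite := walls_finite.subset fun _ h => h.1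
    have hlt : {h ∈ walls b V | 0 < val P h (simpleRefl j x)}.ncard < n := by
      rw [← hn]
      -- `s_j` injects the walls positive at `s_j x` into those positive at `x` and misses `j`, so
      -- their number drops.
      have hsub : reflIdx P j.1 '' {h ∈ walls b V | 0 < val P h (simpleRefl j x)} ⊆
          {h ∈ walls b V | 0 < val P h x} \ {j.1} := by
        rintro _ ⟨h, ⟨hh, h0⟩, rfl⟩
        have hne : h ≠ j.1 := by
          rintro rfl
          rw [simpleRefl, val_affRefl_self] at h0
          linarith
        refine ⟨⟨reflIdx_mem_walls j hh hne, by rwa [val_reflIdx]⟩, fun e => ?_⟩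
        have e' : reflIdx P j.1 h = j.1 := e
        have : val P h (simpleRefl j x) = val P j.1 x := by rw [← e', val_reflIdx]; rfl
        have h2 := reflIdx_involutive P j.1 h
        rw [e'] at h2
        have h3 : val P h x = - val P j.1 x := by
          rw [← h2, val_reflIdx, val_affRefl_self]
        obtain ⟨y, hy⟩ := exists_regular b V
        have h4 := hy h hh
        rw [← h2, val_reflIdx, val_affRefl_self] at h4
        linarith [hy _ j.2.1]
      rw [← Set.ncard_image_of_injective _ (reflIdx_involutive P j.1).injective]
      exact (Set.ncard_le_ncard hsub (hfin.subset Set.sdiff_subset)).trans_lt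
        (Set.ncard_sdiff_singleton_lt_of_mem ⟨j.2.1, hj⟩ hfin)
    obtain ⟨L, hL⟩ := ih _ hlt (simpleRefl j x) rfl
    refine ⟨L ++ [j], ?_⟩
    rw [wordProd_append]
    simpa [wordProd] using hL

theorem exists_word_affRefl {h : ι × ℤ} (hh : h ∈ walls b V) :
    ∃ L : List (Simple b V), wordProd L = affRefl P h := by
  obtain ⟨y, hy⟩ := exists_regular b V
  -- The word takes the point opposite to `y` into `C_V^-`, hence `y` to the positive side of every
  -- wall. The exchange condition then applies to any `h` and expresses `s_h` by two words.
  obtain ⟨L, hL⟩ := exists_word_mem_antiDominant (b := b) (V := V) (V + (V - y))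
  obtain ⟨σ, hσ⟩ := exists_perm_of_mem_weyl (wordProd_mem L)
  have hV : val P (σ h) V = 0 := by rw [hσ, weyl_vertex (wordProd_mem L), val_vertex hh]
  have h1 : val P h (wordProd L (V + (V - y))) ≤ 0 := hL h hh
  have h2 : val P (σ h) (V + (V - y)) = -val P (σ h) y := by
    have e : y = V + (y - V) := by abel
    have := val_affine P (σ h) V (V - y)
    have h3 := val_affine P (σ h) V (y - V)
    rw [← e] at h3
    rw [this, h3, hV, ← neg_sub y V, map_neg]; ring
  have h0 : val P (σ h) y ≠ 0 := by
    rcases mem_walls_or (b := b) hV with h3 | h3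
    · exact (hy _ h3).ne
    · have := hy _ h3
      rw [val_negIdx] at this
      linarith
  rw [← hσ, h2] at h1
  obtain ⟨L', -, hL'⟩ := exchange (x := y) (fun k hk => (hy k hk).le) L h hh (by
    rw [← hσ]
    exact lt_of_le_of_ne (by linarith) h0.symm)
  refine ⟨L' ++ L.reverse, ?_⟩
  rw [wordProd_append, hL', ← wordProd_inv, mul_inv_cancel_right]

theorem exists_word {w : N ≃ᵃ[ℝ] N} (hw : w ∈ weyl b V) :
    ∃ L : List (Simple b V), wordProd L = w := by
  induction hw using Subgroup.closure_induction with
  | mem x hx => obtain ⟨h, hh, rfl⟩ := hx; exact exists_word_affRefl hh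
  | one => exact ⟨[], rfl⟩
  | mul x y _ _ hx hy =>
    obtain ⟨L, rfl⟩ := hx
    obtain ⟨L', rfl⟩ := hy
    exact ⟨L ++ L', wordProd_append L L'⟩
  | inv x _ hx => obtain ⟨L, rfl⟩ := hx; exact ⟨L.reverse, (wordProd_inv L).symm⟩

theorem exists_reducedExpr {w : N ≃ᵃ[ℝ] N} (hw : w ∈ weyl b V) :
    ∃ L : List (Simple b V), IsReducedExpr L w := by
  obtain ⟨L, hL⟩ := exists_word hw
  obtain ⟨L', h1, h2⟩ := Nat.sInf_mem
    (s := {k | ∃ i : List (Simple b V), wordProd i = w ∧ i.length = k}) ⟨_, L, hL, rfl⟩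
  exact ⟨L', h1, h2⟩

theorem len_simpleRefl_mul_le (j : Simple b V) {w : N ≃ᵃ[ℝ] N} (hw : w ∈ weyl b V) :
    len b V (simpleRefl j * w) ≤ len b V w + 1 := by
  obtain ⟨L, rfl, hL⟩ := exists_reducedExpr hw
  rw [← hL]
  exact len_le (wordProd_cons j L)

theorem len_le_simpleRefl_mul (j : Simple b V) {w : N ≃ᵃ[ℝ] N} (hw : w ∈ weyl b V) :
    len b V w ≤ len b V (simpleRefl j * w) + 1 := by
  simpa [simpleRefl_mul_cancel] using
    len_simpleRefl_mul_le j (mul_mem (simpleRefl_mem j) hw)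

theorem len_of_val_pos (j : Simple b V) {w : N ≃ᵃ[ℝ] N} (hw : w ∈ weyl b V) {x : N}
    (hx : x ∈ antiDominant b V) (h0 : 0 < val P j.1 (w x)) :
    len b V (simpleRefl j * w) + 1 = len b V w := by
  obtain ⟨L, rfl, hL⟩ := exists_reducedExpr hw
  obtain ⟨L', h1, h2⟩ := exchange hx L j.1 j.2.1 h0
  have h3 : len b V (simpleRefl j * wordProd L) ≤ L'.length := len_le h2
  have h4 := len_le_simpleRefl_mul j hw
  lia

theorem val_nonpos_of_len_lt (j : Simple b V) {w : N ≃ᵃ[ℝ] N} (hw : w ∈ weyl b V) {x : N}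
    (hx : x ∈ antiDominant b V) (h : len b V w < len b V (simpleRefl j * w)) :
    val P j.1 (w x) ≤ 0 := by
  by_contra! h0
  have := len_of_val_pos j hw hx h0
  lia

theorem IsReducedExpr.tail {j : Simple b V} {L : List (Simple b V)} {w : N ≃ᵃ[ℝ] N}
    (h : IsReducedExpr (j :: L) w) : IsReducedExpr L (simpleRefl j * w) ∧
      len b V (simpleRefl j * w) + 1 = len b V w := by
  obtain ⟨rfl, h2⟩ := h
  rw [wordProd_cons, simpleRefl_mul_cancel] at *
  have h3 := len_simpleRefl_mul_le j (wordProd_mem L)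
  have h4 := len_le (L := L) rfl
  simp only [List.length_cons] at h2
  exact ⟨⟨rfl, by lia⟩, by lia⟩

/-- The antidominant chamber is a strict fundamental domain. -/
theorem eq_of_mem_antiDominant {w : N ≃ᵃ[ℝ] N} (hw : w ∈ weyl b V) {x : N}
    (hx : x ∈ antiDominant b V) (hwx : w x ∈ antiDominant b V) : w x = x := by
  obtain ⟨L, hL⟩ := exists_reducedExpr hw
  induction L generalizing w with
  | nil => rw [← hL.1]; rfl
  | cons j L ih =>
    obtain ⟨h1, h2⟩ := hL.tail
    have hm := mul_mem (simpleRefl_mem j) hw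
    -- Both `w x` and `s_j w x` lie on the nonpositive side of `H_j`, so `w x` lies on it and the
    -- letter `j` can be dropped.
    have h3 := val_nonpos_of_len_lt j hm hx (by rw [simpleRefl_mul_cancel]; lia)
    have e : (simpleRefl j * w) x = simpleRefl j (w x) := rfl
    rw [e, simpleRefl, val_affRefl_self] at h3
    have h4 : val P j.1 (w x) = 0 := le_antisymm (hwx _ j.2.1) (by linarith)
    have h5 : simpleRefl j (w x) = w x := affRefl_of_val_eq_zero P h4
    rw [h5] at e
    rw [← e]
    exact ih hm (by rwa [e]) h1

end Weyl

/-! ### Equivariance under the Weyl group -/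

section Equivariance

variable {P : RootPairing ι ℝ M N} {b : P.Base} {V : N}

theorem mem_halfSpace_congr {h k : ι × ℤ} {x y : N} (e : val P h x = val P k y) (s : SignType) :
    x ∈ halfSpace P h s ↔ y ∈ halfSpace P k s := by
  cases s <;> simp [halfSpace, hyperplane, e]

theorem mem_halfSpace_negIdx {h : ι × ℤ} {x : N} (s : SignType) :
    x ∈ halfSpace P (negIdx P h) (-s) ↔ x ∈ halfSpace P h s := by
  cases s
  · simp [halfSpace, hyperplane, val_negIdx]
  · rw [show (-SignType.neg) = SignType.pos from rfl]
    simp [halfSpace, val_negIdx]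
  · rw [show (-SignType.pos) = SignType.neg from rfl]
    simp [halfSpace, val_negIdx]

theorem exists_inter_halfSpace (h : ι × ℤ) (s t : SignType) :
    ∃ u, ∀ x, x ∈ halfSpace P h u ↔ x ∈ halfSpace P h s ∧ x ∈ halfSpace P h t := by
  by_cases e : s = t
  · exact ⟨s, fun x => by simp [e]⟩
  · refine ⟨.zero, fun x => ?_⟩
    cases s <;> cases t <;> simp only [halfSpace, hyperplane, Set.mem_ofPred_eq] <;> grind

variable (b) in
-- `W_V^a` permutes all affine roots but not the positive ones; sign conditions over a set closed
-- under negation make invariance of faces a mere reindexing.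
theorem exists_signs_iff {A : Set (ι × ℤ)} (hA : ∀ h ∈ A, negIdx P h ∈ A) (F : Set N) :
    (∃ e : ι × ℤ → SignType, F = {x | ∀ h ∈ A, b.IsPos h.1 → x ∈ halfSpace P h (e h)}) ↔
      ∃ e : ι × ℤ → SignType, F = {x | ∀ h ∈ A, x ∈ halfSpace P h (e h)} := by
  classical
  constructor
  · rintro ⟨e, rfl⟩
    refine ⟨fun h => if b.IsPos h.1 then e h else -e (negIdx P h), ?_⟩
    ext x
    refine ⟨fun H h hh => ?_, fun H h hh hp => by simpa [hp] using H h hh⟩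
    dsimp only
    split_ifs with hp
    · exact H h hh hp
    · have := H _ (hA h hh) ((isPos_or_isPos_negIdx b h).resolve_left hp)
      rwa [← mem_halfSpace_negIdx, negIdx_negIdx] at this
  · rintro ⟨e, rfl⟩
    choose u hu using fun h => exists_inter_halfSpace (P := P) h (e h) (-e (negIdx P h))
    refine ⟨u, ?_⟩
    have key : ∀ h x, x ∈ halfSpace P h (u h) ↔
        x ∈ halfSpace P h (e h) ∧ x ∈ halfSpace P (negIdx P h) (e (negIdx P h)) := fun h x => by
      rw [hu, ← mem_halfSpace_negIdx (h := h) (-e _), neg_neg]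
    ext x
    refine ⟨fun H h hh hp => (key h x).2 ⟨H h hh, H _ (hA h hh)⟩, fun H h hh => ?_⟩
    rcases isPos_or_isPos_negIdx b h with hp | hp
    · exact ((key h x).1 (H h hh hp)).1
    · have := ((key _ x).1 (H _ (hA h hh) hp)).2
      rwa [negIdx_negIdx] at this

theorem isFace_iff {F : Set N} : IsFace b F ↔
    F.Nonempty ∧ ∃ e : ι × ℤ → SignType, F = {x | ∀ h, x ∈ halfSpace P h (e h)} := by
  have := exists_signs_iff b (A := Set.univ) (fun _ _ => Set.mem_univ _) F
  simp only [Set.mem_univ, true_imp_iff] at this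
  rw [IsFace, this]

theorem isResidueFace_iff {F : Set N} : IsResidueFace b V F ↔
    ∃ e : ι × ℤ → SignType, F = {x | ∀ h ∈ {h | val P h V = 0}, x ∈ halfSpace P h (e h)} := by
  rw [← exists_signs_iff b (A := {h | val P h V = 0}) (fun h hh => by
    simpa [val_negIdx] using hh) F]
  simp only [IsResidueFace, walls, hyperplane, Set.mem_ofPred_eq, and_imp]
  simp only [imp.swap (b := val P _ V = 0)]

theorem exists_signs_image {A : Set (ι × ℤ)} {F : Set N} {w : N ≃ᵃ[ℝ] N}
    {σ : Equiv.Perm (ι × ℤ)} (hσ : ∀ h x, val P (σ h) x = val P h (w x))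
    (hA : ∀ h, σ h ∈ A ↔ h ∈ A)
    (H : ∃ e : ι × ℤ → SignType, F = {x | ∀ h ∈ A, x ∈ halfSpace P h (e h)}) :
    ∃ e : ι × ℤ → SignType, w '' F = {x | ∀ h ∈ A, x ∈ halfSpace P h (e h)} := by
  obtain ⟨e, rfl⟩ := H
  refine ⟨fun h => e (σ h), ?_⟩
  ext y
  obtain ⟨x, rfl⟩ := w.surjective y
  rw [w.injective.mem_set_image]
  constructor
  · intro H h hh
    exact (mem_halfSpace_congr (hσ h x) _).1 (H _ ((hA h).2 hh))
  · intro H h hh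
    have := H (σ.symm h) ((hA _).1 (by simpa using hh))
    rw [← mem_halfSpace_congr (hσ _ x)] at this
    simpa only [Equiv.apply_symm_apply] using this

theorem dim_image (w : N ≃ᵃ[ℝ] N) (F : Set N) : dim (w '' F) = dim F := by
  have h : Submodule.map w.linear.toLinearMap (vectorSpan ℝ F) = vectorSpan ℝ (w '' F) :=
    AffineMap.map_vectorSpan (w : N →ᵃ[ℝ] N)
  rw [dim, dim, ← h]
  exact LinearEquiv.finrank_map_eq w.linear _

theorem inv_image_image (w : N ≃ᵃ[ℝ] N) (F : Set N) : (w⁻¹ : N ≃ᵃ[ℝ] N) '' (w '' F) = F := by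
  rw [Set.image_image]
  conv_rhs => rw [← Set.image_id F]
  exact Set.image_congr fun x _ => w.symm_apply_apply x

theorem simpleRefl_image_image (j : Simple b V) (F : Set N) :
    simpleRefl j '' (simpleRefl j '' F) = F := by
  conv_lhs => enter [1]; rw [← simpleRefl_inv]
  exact inv_image_image _ _

theorem mul_image (v w : N ≃ᵃ[ℝ] N) (F : Set N) : (v * w : N ≃ᵃ[ℝ] N) '' F = v '' (w '' F) :=
  (Set.image_image v w F).symm

theorem faceType_image {w : N ≃ᵃ[ℝ] N} (hw : w ∈ weyl b V) (F : Set N) :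
    faceType b V (w '' F) = faceType b V F := by
  ext j
  constructor
  · rintro ⟨v, hv, F₀, h1, h2, h3⟩
    exact ⟨w⁻¹ * v, mul_mem (inv_mem hw) hv, F₀, h1, by rw [mul_image, h2, inv_image_image], h3⟩
  · rintro ⟨v, hv, F₀, h1, rfl, h3⟩
    exact ⟨w * v, mul_mem hw hv, F₀, h1, mul_image _ _ _, h3⟩

/-- The type clause is automatic, as types are invariant under `W_V^a`. -/
theorem sendsTo_iff {F : Set N} {w : N ≃ᵃ[ℝ] N} :
    SendsTo b V F w ↔ w ∈ weyl b V ∧ ∃ F₀ ⊆ antiDominant b V, w '' F₀ = F := by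
  constructor
  · rintro ⟨h1, F₀, h2, -, h3⟩; exact ⟨h1, F₀, h2, h3⟩
  · rintro ⟨h1, F₀, h2, rfl⟩; exact ⟨h1, F₀, h2, (faceType_image h1 _).symm, rfl⟩

theorem SendsTo.mul {F : Set N} {w v : N ≃ᵃ[ℝ] N} (h : SendsTo b V F w) (hv : v ∈ weyl b V) :
    SendsTo b V (v '' F) (v * w) := by
  rw [sendsTo_iff] at *
  obtain ⟨h1, F₀, h2, rfl⟩ := h
  exact ⟨mul_mem hv h1, F₀, h2, mul_image _ _ _⟩

theorem faceLen_eq {F : Set N} {w : N ≃ᵃ[ℝ] N} (h : IsMinElt b V F w) :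
    faceLen b V F = len b V w := by
  have : {k | ∃ w, IsMinElt b V F w ∧ len b V w = k} = {len b V w} := by
    ext k
    constructor
    · rintro ⟨v, hv, rfl⟩; exact le_antisymm (hv.2 _ h.1) (h.2 _ hv.1)
    · rintro rfl; exact ⟨w, h, rfl⟩
  rw [faceLen, this]; simp

theorem IsGallery.tail {j : Simple b V} {i : List (Simple b V)} {C : Set N} {gal : List (Set N)}
    (h : IsGallery b V (j :: i) (C :: gal)) : IsGallery b V i gal where
  length_eq := by simpa using h.length_eq
  chamber D hD := h.chamber D (List.mem_cons_of_mem _ hD)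
  panel m hm := by
    have := h.panel (m + 1) (by simpa using hm)
    simpa only [List.getElem_cons_succ] using this

theorem IsPosFoldedGallery.tail {j : Simple b V} {i : List (Simple b V)} {S C : Set N}
    {gal : List (Set N)} (h : IsPosFoldedGallery b V S (j :: i) (C :: gal)) :
    IsPosFoldedGallery b V S i gal := fun m hm hc e => by
  have := h (m + 1) (by simpa using hm) (by simpa using hc) (by simpa using e)
  simpa only [List.getElem_cons_succ] using this

variable [P.IsCrystallographic]

theorem exists_wall_image {w : N ≃ᵃ[ℝ] N} (hw : w ∈ weyl b V) {h : ι × ℤ} (hh : h ∈ walls b V) :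
    ∃ k ∈ walls b V, (∀ x, val P k (w x) = val P h x) ∨ (∀ x, val P k (w x) = -val P h x) := by
  obtain ⟨σ, hσ⟩ := exists_perm_of_mem_weyl hw
  have e : ∀ x, val P (σ.symm h) (w x) = val P h x := fun x => by
    rw [← hσ, Equiv.apply_symm_apply]
  have e0 : val P (σ.symm h) V = 0 := by
    have := e V
    rwa [weyl_vertex hw, val_vertex hh] at this
  rcases mem_walls_or (b := b) e0 with h1 | h1
  · exact ⟨_, h1, .inl e⟩
  · exact ⟨_, h1, .inr fun x => by rw [val_negIdx, e]⟩

theorem IsFace.image {F : Set N} (hF : IsFace b F) {w : N ≃ᵃ[ℝ] N} (hw : w ∈ weyl b V) :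
    IsFace b (w '' F) := by
  obtain ⟨σ, hσ⟩ := exists_perm_of_mem_weyl hw
  rw [isFace_iff] at *
  have := exists_signs_image (A := Set.univ) (F := F) hσ (by simp) (by simpa using hF.2)
  exact ⟨hF.1.image _, by simpa using this⟩

theorem IsResidueFace.image {F : Set N} (hF : IsResidueFace b V F) {w : N ≃ᵃ[ℝ] N}
    (hw : w ∈ weyl b V) : IsResidueFace b V (w '' F) := by
  obtain ⟨σ, hσ⟩ := exists_perm_of_mem_weyl hw
  rw [isResidueFace_iff] at *
  refine exists_signs_image hσ (fun h => ?_) hF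
  simp [hσ, weyl_vertex hw]

theorem IsEdge.image {F : Set N} (hF : IsEdge b F) {w : N ≃ᵃ[ℝ] N} (hw : w ∈ weyl b V) :
    IsEdge b (w '' F) := ⟨hF.1.image hw, by rw [dim_image, hF.2]⟩

theorem IsPanel.image {F : Set N} (hF : IsPanel b V F) {w : N ≃ᵃ[ℝ] N} (hw : w ∈ weyl b V) :
    IsPanel b V (w '' F) := ⟨hF.1.image hw, by rw [dim_image, hF.2]⟩

theorem IsChamber.image {C : Set N} (hC : IsChamber b V C) {w : N ≃ᵃ[ℝ] N} (hw : w ∈ weyl b V) :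
    IsChamber b V (w '' C) := by
  obtain ⟨h1, y, hy, h2⟩ := hC
  refine ⟨h1.image hw, w y, ⟨y, hy, rfl⟩, fun h hh h0 => ?_⟩
  obtain ⟨k, hk, e⟩ := exists_wall_image (inv_mem hw) hh
  have e1 : (w⁻¹ : N ≃ᵃ[ℝ] N) (w y) = y := w.symm_apply_apply y
  have h0' : val P h (w y) = 0 := h0
  refine h2 k hk ?_
  change val P k y = 0
  rw [← e1]
  rcases e with e | e <;> rw [e, h0']
  simp

theorem IsTwoStep.image {E F : Set N} (h : IsTwoStep b V E F) {w : N ≃ᵃ[ℝ] N}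
    (hw : w ∈ weyl b V) : IsTwoStep b V (w '' E) (w '' F) where
  vertex := h.vertex
  edge_left := h.edge_left.image hw
  mem_left := ⟨V, h.mem_left, weyl_vertex hw⟩
  edge_right := h.edge_right.image hw
  mem_right := ⟨V, h.mem_right, weyl_vertex hw⟩

theorem exists_root'_linear {w : N ≃ᵃ[ℝ] N} (hw : w ∈ weyl b V) (i : ι) :
    ∃ k, ∀ d, P.root' i (w.linear d) = P.root' k d := by
  obtain ⟨σ, hσ⟩ := exists_perm_of_mem_weyl hw
  refine ⟨(σ (i, 0)).1, fun d => ?_⟩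
  have h1 := hσ (i, 0) (V + d)
  have h2 := hσ (i, 0) V
  have e : w (V + d) = w V + w.linear d := by
    have := w.map_vadd V d
    simpa [add_comm] using this
  rw [val_affine, e, val_affine, h2] at h1
  simpa using h1.symm

theorem IsMinimal.image {E F : Set N} (h : IsMinimal b V E F) {w : N ≃ᵃ[ℝ] N}
    (hw : w ∈ weyl b V) : IsMinimal b V (w '' E) (w '' F) := by
  obtain ⟨h1, _, ⟨y, hy, rfl⟩, h2, h3⟩ := h
  choose τ hτ using exists_root'_linear hw
  refine ⟨h1.image hw, _, ⟨w.linear y, fun i => by rw [hτ]; exact hy _, rfl⟩, ?_, ?_⟩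
  · rintro _ ⟨_, hx, rfl⟩
    obtain ⟨c, hc, rfl⟩ := h2 hx
    refine ⟨w.linear c, fun i => by rw [hτ, hτ]; exact hc _, ?_⟩
    have := w.map_vadd V c
    simp only [vadd_eq_add, weyl_vertex hw] at this
    simp only [add_comm V, this]
  · rintro _ ⟨_, hx, rfl⟩
    obtain ⟨c, hc, rfl⟩ := h3 hx
    refine ⟨w.linear c, fun i => by rw [hτ, hτ]; exact hc _, ?_⟩
    have := w.map_vadd V (-c)
    simp only [vadd_eq_add, weyl_vertex hw, map_neg] at this
    simp only [sub_eq_neg_add, this]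

theorem openFace_image_subset {w : N ≃ᵃ[ℝ] N} (hw : w ∈ weyl b V) (F : Set N) :
    openFace b V (w '' F) ⊆ w '' openFace b V F := by
  rintro _ ⟨⟨x, hx, rfl⟩, H⟩
  refine ⟨x, ⟨hx, fun h hh h0 y hy => ?_⟩, rfl⟩
  change val P h x = 0 at h0
  obtain ⟨k, hk, e⟩ := exists_wall_image hw hh
  have h1 : w x ∈ hyperplane P k := by
    change val P k (w x) = 0
    rcases e with e | e <;> rw [e, h0]
    simp
  have h2 : val P k (w y) = 0 := H k hk h1 ⟨y, hy, rfl⟩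
  change val P h y = 0
  rcases e with e | e <;> rw [e] at h2
  · exact h2
  · linarith

theorem Separates.image {Ω G : Set N} {h : ι × ℤ} (hs : Separates b V h Ω G)
    (hh : h ∈ walls b V) {w : N ≃ᵃ[ℝ] N} (hw : w ∈ weyl b V) :
    ∃ k ∈ walls b V, Separates b V k (w '' Ω) (w '' G) ∧
      ∀ F, F ⊆ hyperplane P h → w '' F ⊆ hyperplane P k := by
  obtain ⟨k, hk, e⟩ := exists_wall_image hw hh
  refine ⟨k, hk, ?_, ?_⟩
  · have hso := openFace_image_subset hw G
    rcases e with e | e <;> rcases hs with ⟨h1, h2⟩ | ⟨h1, h2⟩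
    · left
      refine ⟨?_, fun y hy => ?_⟩
      · rintro _ ⟨x, hx, rfl⟩; simpa [e] using h1 hx
      · obtain ⟨x, hx, rfl⟩ := hso hy; simpa [e] using h2 hx
    · right
      refine ⟨?_, fun y hy => ?_⟩
      · rintro _ ⟨x, hx, rfl⟩; simpa [e] using h1 hx
      · obtain ⟨x, hx, rfl⟩ := hso hy; simpa [e] using h2 hx
    · right
      refine ⟨?_, fun y hy => ?_⟩
      · rintro _ ⟨x, hx, rfl⟩; simpa [e] using h1 hx
      · obtain ⟨x, hx, rfl⟩ := hso hy; simpa [e] using h2 hx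
    · left
      refine ⟨?_, fun y hy => ?_⟩
      · rintro _ ⟨x, hx, rfl⟩; simpa [e] using h1 hx
      · obtain ⟨x, hx, rfl⟩ := hso hy; simpa [e] using h2 hx
  · rintro F hF _ ⟨x, hx, rfl⟩
    have h0 : val P h x = 0 := hF hx
    change val P k (w x) = 0
    rcases e with e | e <;> rw [e, h0]
    simp

theorem IsGallery.map {i : List (Simple b V)} {gal : List (Set N)} (h : IsGallery b V i gal)
    {w : N ≃ᵃ[ℝ] N} (hw : w ∈ weyl b V) : IsGallery b V i (gal.map fun C => w '' C) where
  length_eq := by simpa using h.length_eq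
  chamber D hD := by
    obtain ⟨C, hC, rfl⟩ := List.mem_map.1 hD
    exact (h.chamber C hC).image hw
  panel m hm := by
    obtain ⟨H, h1, h2, h3, h4⟩ := h.panel m hm
    refine ⟨w '' H, h1.image hw, by rw [faceType_image hw, h2], ?_, ?_⟩
    · rw [List.getElem_map]; exact Set.image_mono h3
    · rw [List.getElem_map]; exact Set.image_mono h4

theorem IsPosFoldedGallery.map {i : List (Simple b V)} {S : Set N} {gal : List (Set N)}
    (h : IsPosFoldedGallery b V S i gal) {w : N ≃ᵃ[ℝ] N} (hw : w ∈ weyl b V) :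
    IsPosFoldedGallery b V (w '' S) i (gal.map fun C => w '' C) := fun m hm hc e => by
  rw [List.getElem_map, List.getElem_map] at e
  obtain ⟨H, h1, h2, h3, k, hk, h4, h5⟩ := h m hm (by simpa using hc) (w.injective.image_injective e)
  obtain ⟨k', hk', h6, h7⟩ := h5.image hk hw
  refine ⟨w '' H, h1.image hw, by rw [faceType_image hw, h2], ?_, k', hk', h7 H h4, ?_⟩
  · rw [List.getElem_map]; exact Set.image_mono h3
  · rw [List.getElem_map]; exact h6

end Equivariance

/-! ### Panels and chambers -/

section Panels

variable {P : RootPairing ι ℝ M N} {b : P.Base} {V : N}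

theorem vertex_mem {F : Set N} (hF : IsResidueFace b V F) : V ∈ F := by
  obtain ⟨e, rfl⟩ := hF
  intro h hh
  cases e h <;> simp [halfSpace, hyperplane, val_vertex hh]

theorem add_mem_residueFace {F : Set N} (hF : IsResidueFace b V F) {x y : N} (hx : x ∈ F)
    (hy : y ∈ F) : x + (y - V) ∈ F := by
  obtain ⟨e, rfl⟩ := hF
  intro h hh
  have h1 := hx h hh
  have h2 := hy h hh
  have h3 : val P h (x + (y - V)) = val P h x + val P h y := by
    rw [val_affine, ← val_eq_root' hh]
  revert h1 h2
  generalize e h = s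
  cases s <;> simp only [halfSpace, hyperplane, Set.mem_ofPred_eq, h3] <;> intros <;> linarith

theorem mem_simpleRefl_image (j : Simple b V) (F : Set N) (x : N) :
    x ∈ simpleRefl j '' F ↔ simpleRefl j x ∈ F := by
  have hi : ∀ x, simpleRefl j (simpleRefl j x) = x := affRefl_affRefl P j.1
  constructor
  · rintro ⟨y, hy, rfl⟩; rwa [hi]
  · intro h; exact ⟨_, h, hi x⟩

variable [P.IsReduced]

/-- By dimension, the direction of `F` is the kernel of both roots, so these are proportional, hence
equal up to sign by reducedness; both being positive settles the sign. -/
theorem wall_eq_of_subset {F : Set N} (hF : dim F + 1 = Module.finrank ℝ N) {h k : ι × ℤ}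
    (hh : h ∈ walls b V) (hk : k ∈ walls b V) (h1 : F ⊆ hyperplane P h)
    (h2 : F ⊆ hyperplane P k) : h = k := by
  -- Since `finrank` is `0` in infinite dimension, the equation for `dim F` already forces finite
  -- dimension.
  have : Module.Finite ℝ N := Module.finite_of_finrank_pos (by lia)
  have hle : ∀ l : ι × ℤ, F ⊆ hyperplane P l → vectorSpan ℝ F ≤ LinearMap.ker (P.root' l.1) := by
    intro l hl
    rw [vectorSpan, Submodule.span_le]
    rintro _ ⟨x, hx, y, hy, rfl⟩
    have e1 : val P l x = 0 := hl hx
    have e2 : val P l y = 0 := hl hy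
    simp only [val] at e1 e2
    simp only [vsub_eq_sub, SetLike.mem_coe, LinearMap.mem_ker, map_sub]
    linarith
  have hker : ∀ l : ι × ℤ, F ⊆ hyperplane P l →
      vectorSpan ℝ F = LinearMap.ker (P.root' l.1) := by
    intro l hl
    refine Submodule.eq_of_le_of_finrank_eq (hle l hl) ?_
    have hlt : Module.finrank ℝ (LinearMap.ker (P.root' l.1)) < Module.finrank ℝ N := by
      refine Submodule.finrank_lt fun ht => ?_
      have : P.coroot l.1 ∈ LinearMap.ker (P.root' l.1) := ht ▸ Submodule.mem_top
      simp at this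
    have := Submodule.finrank_mono (hle l hl)
    rw [dim] at hF
    lia
  have hkk := (hker h h1).symm.trans (hker k h2)
  have hpr : ∀ x, P.root' k.1 x = P.pairing k.1 h.1 / 2 * P.root' h.1 x := fun x => by
    have : x - (P.root' h.1 x / 2) • P.coroot h.1 ∈ LinearMap.ker (P.root' h.1) := by
      simp
    rw [hkk, LinearMap.mem_ker, map_sub, map_smul, RootPairing.root'_coroot_eq_pairing,
      smul_eq_mul] at this
    linarith
  have hrt : P.root k.1 = (P.pairing k.1 h.1 / 2) • P.root h.1 := by
    apply P.toPerfPair.injective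
    ext x
    rw [map_smul]
    exact hpr x
  have hd : ¬ LinearIndependent ℝ ![P.root h.1, P.root k.1] := by
    intro hl
    have := LinearIndependent.pair_iff.mp hl (P.pairing k.1 h.1 / 2) (-1) (by rw [hrt]; module)
    simp at this
  rcases RootPairing.IsReduced.eq_or_eq_neg _ _ hd with e | e
  · exact wall_ext hh hk (P.root.injective e)
  · obtain ⟨y, hy⟩ := exists_regular b V
    have e1 := hy h hh
    have e2 := hy k hk
    rw [val_eq_root' hh] at e1
    rw [val_eq_root' hk] at e2
    have : P.root' h.1 (y - V) = -P.root' k.1 (y - V) := by simp [RootPairing.root', e]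
    linarith

variable [Finite ι]

/-- `F` is a cone closed under addition based at `V`. Each wall other than `k` is strictly negative
somewhere on `F`, and the sum of such points serves all walls at once. -/
theorem exists_generic_of_subset {F : Set N} (hF : IsPanel b V F) (hs : F ⊆ antiDominant b V)
    {k : ι × ℤ} (hk : k ∈ walls b V) (hFk : F ⊆ hyperplane P k) :
    ∃ p ∈ F, ∀ h ∈ walls b V, h ≠ k → val P h p < 0 := by
  have hfin : {h ∈ walls b V | h ≠ k}.Finite := walls_finite.subset fun _ h => h.1
  suffices H : ∀ T : Set (ι × ℤ), T.Finite → T ⊆ {h ∈ walls b V | h ≠ k} →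
      ∃ p ∈ F, ∀ h ∈ T, val P h p < 0 by
    obtain ⟨p, hp, h⟩ := H _ hfin subset_rfl
    exact ⟨p, hp, fun h' hh' hne => h h' ⟨hh', hne⟩⟩
  intro T hT
  induction T, hT using Set.Finite.induction_on with
  | empty => exact fun _ => ⟨V, vertex_mem hF.1, by simp⟩
  | @insert a T _ _ ih =>
    intro hsub
    obtain ⟨p, hp, h1⟩ := ih ((Set.subset_insert a T).trans hsub)
    obtain ⟨ha, hne⟩ := hsub (Set.mem_insert a T)
    obtain ⟨q, hq, h2⟩ : ∃ q ∈ F, val P a q < 0 := by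
      by_contra! H
      exact hne (wall_eq_of_subset hF.2 ha hk (fun x hx => le_antisymm (hs hx a ha) (H x hx)) hFk)
    refine ⟨p + (q - V), add_mem_residueFace hF.1 hp hq, fun h hh => ?_⟩
    have hw := (hsub hh).1
    rw [val_affine, ← val_eq_root' hw]
    rcases Set.mem_insert_iff.1 hh with rfl | hh
    · linarith [hs hp h hw]
    · linarith [h1 h hh, hs hq h hw]

variable [P.IsCrystallographic]

theorem eq_of_image_subset {w : N ≃ᵃ[ℝ] N} (hw : w ∈ weyl b V) {F : Set N}
    (h1 : F ⊆ antiDominant b V) (h2 : w '' F ⊆ antiDominant b V) : w '' F = F := by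
  conv_rhs => rw [← Set.image_id F]
  exact Set.image_congr fun x hx => eq_of_mem_antiDominant hw (h1 hx) (h2 ⟨x, hx, rfl⟩)

/-- By the strict fundamental domain, the only conjugate of `F` inside `C_V^-` is `F` itself. -/
theorem faceType_of_subset {F : Set N} (hF : F ⊆ antiDominant b V) :
    faceType b V F = {j | F ⊆ hyperplane P j.1} := by
  ext j
  constructor
  · rintro ⟨w, hw, F₀, h1, rfl, h3⟩
    rw [eq_of_image_subset hw h1 hF]
    exact h3
  · intro h
    exact ⟨1, one_mem _, F, hF, Set.image_id F, h⟩

theorem IsPanel.subset_hyperplane {F : Set N} (hs : F ⊆ antiDominant b V) {j : Simple b V}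
    (ht : faceType b V F = {j}) : F ⊆ hyperplane P j.1 := by
  have : j ∈ faceType b V F := by simp [ht]
  rwa [faceType_of_subset hs] at this

theorem simpleRefl_mem_antiDominant_iff (j : Simple b V) (x : N) :
    simpleRefl j x ∈ antiDominant b V ↔
      0 ≤ val P j.1 x ∧ ∀ h ∈ walls b V, h ≠ j.1 → val P h x ≤ 0 := by
  have key : ∀ h, val P h (simpleRefl j x) = val P (reflIdx P j.1 h) x := fun h =>
    (val_reflIdx P j.1 h x).symm
  have hself : val P j.1 (simpleRefl j x) = -val P j.1 x := val_affRefl_self P j.1 x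
  have hinv := reflIdx_involutive P j.1
  have hne : ∀ h ∈ walls b V, h ≠ j.1 → reflIdx P j.1 h ≠ j.1 := fun h hh hne e => by
    obtain ⟨y, hy⟩ := exists_regular b V
    have h1 := hy h hh
    rw [← hinv h, e, val_reflIdx, val_affRefl_self] at h1
    linarith [hy _ j.2.1]
  constructor
  · intro H
    have h1 := H _ j.2.1
    refine ⟨by linarith, fun h hh hn => ?_⟩
    have := H _ (reflIdx_mem_walls j hh hn)
    rwa [key, hinv] at this
  · rintro ⟨h0, H⟩ h hh
    by_cases e : h = j.1
    · subst e; linarith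
    · rw [key]; exact H _ (reflIdx_mem_walls j hh e) (hne h hh e)

theorem antiDominant_ne (j : Simple b V) : simpleRefl j '' antiDominant b V ≠ antiDominant b V := by
  intro e
  obtain ⟨y, hy⟩ := exists_regular b V
  have h1 : y ∈ antiDominant b V := fun h hh => (hy h hh).le
  rw [← e, mem_simpleRefl_image, simpleRefl_mem_antiDominant_iff] at h1
  linarith [hy _ j.2.1]

/-- A generic point of the panel forces the sign of `C` at every wall except `j`; the two nonzero
signs left at `j` give the two chambers. -/
theorem chamber_eq_or_eq {C F : Set N} (hC : IsChamber b V C) (hF : IsPanel b V F)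
    {j : Simple b V} (ht : faceType b V F = {j}) (hs : F ⊆ antiDominant b V) (hFC : F ⊆ C) :
    C = antiDominant b V ∨ C = simpleRefl j '' antiDominant b V := by
  obtain ⟨p, hp, hpn⟩ := exists_generic_of_subset hF hs j.2.1 (IsPanel.subset_hyperplane hs ht)
  have hpC := hFC hp
  obtain ⟨⟨e, rfl⟩, y, hyC, hy⟩ := hC
  have hn : ∀ h ∈ walls b V, h ≠ j.1 → e h = .neg := by
    intro h hh hne
    have h1 := hpn h hh hne
    have h2 := hpC h hh
    revert h2
    cases e h
    · intro h2; exact absurd h2 h1.ne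
    · intro _; rfl
    · intro h2; exact absurd h2 (not_le.mpr h1)
  cases hj : e j.1
  · have := hyC _ j.2.1
    rw [hj] at this
    exact absurd this (hy _ j.2.1)
  · left
    ext x
    refine forall₂_congr fun h hh => ?_
    by_cases hne : h = j.1
    · subst hne; rw [hj]; rfl
    · rw [hn h hh hne]; rfl
  · right
    ext x
    rw [mem_simpleRefl_image, simpleRefl_mem_antiDominant_iff]
    constructor
    · intro H
      refine ⟨by have := H _ j.2.1; rwa [hj] at this, fun h hh hne => ?_⟩
      have := H h hh
      rwa [hn h hh hne] at this
    · rintro ⟨h0, H⟩ h hh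
      by_cases hne : h = j.1
      · subst hne; rw [hj]; exact h0
      · rw [hn h hh hne]; exact H h hh hne

theorem exists_image_antiDominant_eq {S : Set N} (hS : IsChamber b V S) :
    ∃ w ∈ weyl b V, w '' antiDominant b V = S := by
  have h0 := hS
  obtain ⟨-, y, hyS, hy⟩ := h0
  obtain ⟨L, hL⟩ := exists_word_mem_antiDominant (b := b) (V := V) y
  have hw := wordProd_mem L
  refine ⟨(wordProd L)⁻¹, inv_mem hw, ?_⟩
  suffices H : antiDominant b V = wordProd L '' S by rw [H, inv_image_image]
  obtain ⟨e, he⟩ := hS.1.image hw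
  have hr : ∀ h ∈ walls b V, val P h (wordProd L y) ≠ 0 := by
    intro h hh h0
    obtain ⟨k, hk, e⟩ := exists_wall_image (inv_mem hw) hh
    have e1 : ((wordProd L)⁻¹ : N ≃ᵃ[ℝ] N) (wordProd L y) = y := (wordProd L).symm_apply_apply y
    refine hy k hk ?_
    change val P k y = 0
    rw [← e1]
    rcases e with e | e <;> rw [e, h0]
    simp
  have hm : wordProd L y ∈ wordProd L '' S := ⟨y, hyS, rfl⟩
  rw [he] at hm ⊢
  ext x
  refine forall₂_congr fun h hh => ?_
  have h1 := hm h hh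
  have h2 := (hL h hh).lt_of_ne (hr h hh)
  revert h1
  cases e h
  · intro h1; exact absurd h1 h2.ne
  · intro _; rfl
  · intro h1; exact absurd h1 (not_le.mpr h2)

end Panels

/-! ### Edges at a vertex -/

section Edges

/-- Local finiteness of the affine arrangement: the bound is uniform over the infinitely many
hyperplanes parallel to a given one. -/
theorem exists_gap (r : ℝ) : ∃ δ > 0, ∀ n : ℤ, r - n = 0 ∨ δ ≤ |r - n| := by
  by_cases hr : Int.fract r = 0
  · refine ⟨1, one_pos, fun n => ?_⟩
    have e : r = ⌊r⌋ := by have := Int.floor_add_fract r; rw [hr] at this; linarith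
    rw [e]
    by_cases h : ⌊r⌋ - n = 0
    · left; exact_mod_cast h
    · right; exact_mod_cast Int.one_le_abs h
  · have h0 := (Int.fract_nonneg r).lt_of_ne' hr
    have h1 := Int.fract_lt_one r
    refine ⟨min (Int.fract r) (1 - Int.fract r), lt_min h0 (by linarith), fun n => .inr ?_⟩
    have e := Int.floor_add_fract r
    rcases lt_or_ge ⌊r⌋ n with h | h
    · have : (⌊r⌋ : ℝ) + 1 ≤ n := by exact_mod_cast h
      exact (min_le_right _ _).trans ((by linarith : _ ≤ -(r - n)).trans (neg_le_abs _))
    · have : (n : ℝ) ≤ ⌊r⌋ := by exact_mod_cast h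
      exact (min_le_left _ _).trans ((by linarith : _ ≤ r - n).trans (le_abs_self _))

variable {P : RootPairing ι ℝ M N} {b : P.Base} {V : N}

open Filter Topology in
-- Hyperplanes through `p` are parallel to `d`, and all others keep a positive distance, so a short
-- move along `d` changes no sign.
theorem exists_add_smul_mem [Finite ι] {F : Set N} (hF : IsFace b F) {p d : N} (hp : p ∈ F)
    (hd : ∀ h, val P h p = 0 → P.root' h.1 d = 0) : ∃ t > (0 : ℝ), p + t • d ∈ F := by
  obtain ⟨-, e, rfl⟩ := isFace_iff.1 hF
  choose δ hδ hgap using fun i => exists_gap (P.root' i p)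
  have hev : ∀ᶠ t in 𝓝[>] (0 : ℝ), ∀ i, |t * P.root' i d| < δ i := by
    rw [eventually_all]
    intro i
    have : Tendsto (fun t : ℝ => |t * P.root' i d|) (𝓝[>] 0) (𝓝 0) := by
      have h : Continuous fun t : ℝ => |t * P.root' i d| := by fun_prop
      simpa using (h.tendsto 0).mono_left nhdsWithin_le_nhds
    exact this.eventually_lt_const (hδ i)
  obtain ⟨t, ht, h0⟩ := (hev.and self_mem_nhdsWithin).exists
  refine ⟨t, h0, fun h => ?_⟩
  have hv : val P h (p + t • d) = val P h p + t * P.root' h.1 d := by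
    rw [val_affine, map_smul, smul_eq_mul]
  have hph := hp h
  rcases hgap h.1 h.2 with h1 | h1
  · refine (mem_halfSpace_congr ?_ _).1 hph
    rw [hv, hd h h1]; ring
  · have h2 := abs_lt.1 (ht h.1)
    have h3 := hδ h.1
    change δ h.1 ≤ |val P h p| at h1
    revert hph
    cases e h <;> simp only [halfSpace, hyperplane, Set.mem_ofPred_eq, hv] <;> intro hph
    · rw [hph, abs_zero] at h1; linarith
    · rw [abs_of_nonpos hph] at h1; linarith
    · rw [abs_of_nonneg hph] at h1; linarith

theorem eq_vertex [Finite ι] (hV : IsVertex b V) {x : N} (hx : ∀ h ∈ walls b V, val P h x = 0) :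
    x = V := by
  obtain ⟨t, ht, hm⟩ := exists_add_smul_mem (d := x - V) hV (Set.mem_singleton V) fun h hh => by
    have key : ∀ k ∈ walls b V, P.root' k.1 (x - V) = 0 := fun k hk => by
      rw [← val_eq_root' hk, hx k hk]
    rcases mem_walls_or (b := b) hh with h1 | h1
    · exact key h h1
    · have := key _ h1
      simp only [negIdx, root'_reflectionPerm, RootPairing.pairing_same] at this
      linarith
  have : t • (x - V) = 0 := by simpa using hm
  rcases smul_eq_zero.1 this with h | h
  · exact absurd h ht.ne'
  · exact sub_eq_zero.1 h

theorem IsEdge.exists_ne {F : Set N} (hF : IsEdge b F) : ∃ x ∈ F, x ≠ V := by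
  by_contra! H
  have : vectorSpan ℝ F = ⊥ := by
    rw [vectorSpan_eq_bot_iff_subsingleton]
    intro x hx y hy
    rw [H x hx, H y hy]
  have h := hF.2
  rw [dim, this] at h
  simp at h

theorem IsEdge.exists_smul {F : Set N} (hF : IsEdge b F) (hV : V ∈ F) {x y : N} (hx : x ∈ F)
    (hne : x ≠ V) (hy : y ∈ F) : ∃ r : ℝ, y = V + r • (x - V) := by
  let v : vectorSpan ℝ F := ⟨x -ᵥ V, vsub_mem_vectorSpan ℝ hx hV⟩
  have hv : v ≠ 0 := fun h => hne (by
    have := congrArg Subtype.val h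
    simpa [v, sub_eq_zero] using this)
  obtain ⟨r, hr⟩ := (finrank_eq_one_iff_of_nonzero' v hv).1 hF.2
    ⟨y -ᵥ V, vsub_mem_vectorSpan ℝ hy hV⟩
  refine ⟨r, ?_⟩
  have := congrArg Subtype.val hr
  simp only [v, vsub_eq_sub, Submodule.coe_smul] at this
  rw [this]; abel

theorem val_line (h : ι × ℤ) (x : N) (r : ℝ) :
    val P h (V + r • (x - V)) = (1 - r) * val P h V + r * val P h x := by
  have := val_affine P h V (x - V)
  rw [add_sub_cancel] at this
  rw [val_affine, map_smul, this, smul_eq_mul]; ring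

/-- The signs defining a face are not unique, but those at a relatively interior point are
intrinsic. Hence two edges with a common such point coincide. -/
theorem IsEdge.mem_iff {F : Set N} (hF : IsEdge b F) (hV : V ∈ F) {x : N} (hx : x ∈ F)
    (hne : x ≠ V) {s : ℝ} (h0 : 0 < s) (h1 : s < 1) (y : N) :
    y ∈ F ↔ ∀ h, (val P h (V + s • (x - V)) = 0 → val P h y = 0) ∧
      (0 < val P h (V + s • (x - V)) → 0 ≤ val P h y) ∧
      (val P h (V + s • (x - V)) < 0 → val P h y ≤ 0) := by
  have h1' : 0 < 1 - s := by linarith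
  have hline := fun hy => hF.exists_smul hV hx hne (y := y) hy
  obtain ⟨-, e, rfl⟩ := isFace_iff.1 hF.1
  constructor
  · intro hy h
    obtain ⟨r, rfl⟩ := hline hy
    have hVh := hV h
    have hxh := hx h
    have hyh := hy h
    have hpos : ∀ {a c : ℝ}, 0 ≤ a → 0 ≤ c → (1 - s) * a + s * c = 0 → a = 0 ∧ c = 0 := by
      intro a c ha hc h
      have h2 := mul_nonneg h1'.le ha
      have h3 := mul_nonneg h0.le hc
      exact ⟨(mul_eq_zero.1 (by linarith : (1 - s) * a = 0)).resolve_left h1'.ne',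
        (mul_eq_zero.1 (by linarith : s * c = 0)).resolve_left h0.ne'⟩
    revert hVh hxh hyh
    cases e h <;> simp only [halfSpace, hyperplane, Set.mem_ofPred_eq, val_line] <;>
      generalize val P h V = a <;> generalize val P h x = c <;> intro ha hc hy
    · simp [ha, hc]
    · refine ⟨fun h => ?_, fun h => absurd h (not_lt.2 ?_), fun _ => hy⟩
      · obtain ⟨h2, h3⟩ := hpos (neg_nonneg.2 ha) (neg_nonneg.2 hc) (by linarith)
        rw [neg_eq_zero.1 h2, neg_eq_zero.1 h3]; ring
      · have h2 := mul_nonneg h1'.le (neg_nonneg.2 ha)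
        have h3 := mul_nonneg h0.le (neg_nonneg.2 hc)
        linarith
    · refine ⟨fun h => ?_, fun _ => hy, fun h => absurd h (not_lt.2 (by positivity))⟩
      obtain ⟨h2, h3⟩ := hpos ha hc h
      rw [h2, h3]; ring
  · intro H h
    have hVh := hV h
    have hxh := hx h
    obtain ⟨e1, e2, e3⟩ := H h
    have hp := val_line (P := P) (V := V) h x s
    rw [hp] at e1 e2 e3
    revert hVh hxh
    cases e h <;> simp only [halfSpace, hyperplane, Set.mem_ofPred_eq] <;> intro hVh hxh
    · exact e1 (by rw [hVh, hxh]; ring)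
    · rcases (show (1 - s) * val P h V + s * val P h x ≤ 0 from
        add_nonpos (mul_nonpos_of_nonneg_of_nonpos h1'.le hVh)
          (mul_nonpos_of_nonneg_of_nonpos h0.le hxh)).lt_or_eq with h | h
      · exact e3 h
      · exact (e1 h).le
    · rcases (show 0 ≤ (1 - s) * val P h V + s * val P h x by positivity).lt_or_eq with h | h
      · exact e2 h
      · exact (e1 h.symm).ge

theorem IsEdge.subset_hyperplane_iff {F : Set N} (hF : IsEdge b F) (hV : V ∈ F) {x : N}
    (hx : x ∈ F) (hne : x ≠ V) {h : ι × ℤ} (hh : h ∈ walls b V) :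
    F ⊆ hyperplane P h ↔ val P h x = 0 := by
  refine ⟨fun H => H hx, fun H y hy => ?_⟩
  obtain ⟨r, rfl⟩ := hF.exists_smul hV hx hne hy
  change val P h _ = 0
  rw [val_line, H, val_vertex hh]; ring

variable [Finite ι] [P.IsCrystallographic] [P.IsReduced]

/-- An edge of the antidominant chamber is determined by its type. -/
theorem IsEdge.eq_of_faceType_eq (hv : IsVertex b V) {E F : Set N} (hE : IsEdge b E)
    (hF : IsEdge b F) (hVE : V ∈ E) (hVF : V ∈ F) (hEs : E ⊆ antiDominant b V)
    (hFs : F ⊆ antiDominant b V) (ht : faceType b V E = faceType b V F) : E = F := by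
  obtain ⟨x, hx, hxV⟩ := hE.exists_ne (V := V)
  obtain ⟨y, hy, hyV⟩ := hF.exists_ne (V := V)
  have hxy : ∀ h ∈ walls b V, val P h x = 0 → val P h y = 0 := by
    refine val_eq_zero_of_simple (hEs hx) fun j hj => ?_
    have h1 : j ∈ faceType b V E := by
      rw [faceType_of_subset hEs]
      exact (hE.subset_hyperplane_iff hVE hx hxV j.2.1).2 hj
    rw [ht, faceType_of_subset hFs] at h1
    exact h1 hy
  have hmid : V + (1 / 2 : ℝ) • (x - V) ∈ E :=
    (hE.mem_iff hVE hx hxV (s := 1 / 2) (by norm_num) (by norm_num) _).2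
      fun h => ⟨id, le_of_lt, le_of_lt⟩
  -- Every hyperplane containing the midpoint of `V` and `x` contains both, hence also `y` by the
  -- equality of types. So `E` extends a little in the direction `y - V`, and `y` lies on the line
  -- of `E`.
  obtain ⟨t, ht0, htm⟩ := exists_add_smul_mem (d := y - V) hE.1 hmid fun h hh => by
    have h1 := ((hE.mem_iff hVE hx hxV (s := 1 / 2) (by norm_num) (by norm_num) V).1 hVE h).1 hh
    have h2 := ((hE.mem_iff hVE hx hxV (s := 1 / 2) (by norm_num) (by norm_num) x).1 hx h).1 hh
    have h3 : val P h y = 0 := by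
      rcases mem_walls_or (b := b) h1 with h4 | h4
      · exact hxy h h4 h2
      · have := hxy _ h4 (by rw [val_negIdx, h2, neg_zero])
        rwa [val_negIdx, neg_eq_zero] at this
    simp only [val] at h1 h3
    rw [map_sub]; linarith
  obtain ⟨r, hr⟩ := hE.exists_smul hVE hx hxV htm
  obtain ⟨c, hc⟩ : ∃ c : ℝ, y = V + c • (x - V) := by
    refine ⟨(r - 1 / 2) / t, ?_⟩
    have h1 : t • (y - V) = (r - 1 / 2) • (x - V) := by
      rw [sub_smul, eq_sub_iff_add_eq]
      rw [add_assoc, add_left_cancel_iff] at hr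
      rw [← hr]; abel
    rw [div_eq_inv_mul, mul_smul, ← h1, inv_smul_smul₀ ht0.ne']; abel
  -- For `c < 0`, both `x` and a point opposite to it lie in `C_V^-`, so `x` is on all walls and
  -- equals the vertex `V`.
  have hc0 : 0 < c := by
    rcases lt_trichotomy c 0 with h | h | h
    · refine absurd (eq_vertex hv fun k hk => ?_) hxV
      have h1 := hFs hy k hk
      have h2 := hEs hx k hk
      rw [hc, val_line, val_vertex hk] at h1
      nlinarith
    · rw [h] at hc; simp [hyV] at hc
    · exact h
  -- The parameters `c / (2(1 + c))` on `E` and `1 / (2(1 + c))` on `F` give the same point,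
  -- interior to both edges.
  have hs : 1 / (2 * (1 + c)) < 1 := by rw [div_lt_one (by positivity)]; linarith
  have hs' : c / (2 * (1 + c)) < 1 := by rw [div_lt_one (by positivity)]; linarith
  have e : V + (c / (2 * (1 + c))) • (x - V) = V + (1 / (2 * (1 + c))) • (y - V) := by
    rw [hc, add_sub_cancel_left, smul_smul]
    congr 2; ring
  ext z
  rw [hE.mem_iff hVE hx hxV (by positivity) hs' z, hF.mem_iff hVF hy hyV (by positivity) hs z, e]

end Edges

/-! ### Chains of positive foldings -/

section Foldings

variable {P : RootPairing ι ℝ M N} {b : P.Base} {V : N}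

/-- `C_V^-` contains regular points, strictly negative on every wall, which excludes one alternative
of the separation. -/
theorem isPosFolding_iff {F' F : Set N} : IsPosFolding b V F' F ↔
    ∃ h ∈ walls b V, affRefl P h '' F' = F ∧ (∀ x ∈ F', val P h x ≤ 0) ∧
      ∀ x ∈ openFace b V F, 0 < val P h x := by
  refine exists_congr fun h => and_congr_right fun hh => and_congr_right fun _ => ?_
  constructor
  · rintro (⟨h1, -⟩ | ⟨h1, h2⟩)
    · obtain ⟨y, hy⟩ := exists_regular b V
      have : 0 ≤ val P h y := h1 (.inl fun k hk => (hy k hk).le)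
      linarith [hy h hh]
    · exact ⟨fun x hx => h1 (.inr hx), h2⟩
  · rintro ⟨h1, h2⟩
    exact .inr ⟨Set.union_subset (fun x hx => hx h hh) h1, h2⟩

theorem IsGallery.exists_cons {j : Simple b V} {i : List (Simple b V)} {gal : List (Set N)}
    (h : IsGallery b V (j :: i) gal) (hd : gal.head? = some (antiDominant b V)) :
    ∃ C tl, gal = antiDominant b V :: C :: tl := by
  have hl := h.length_eq
  match gal, hl, hd with
  | [], _, hd => simp at hd
  | [_], hl, _ => simp at hl
  | A :: C :: tl, _, hd => exact ⟨C, tl, by simpa using hd⟩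

theorem IsMinElt.subset_antiDominant {F : Set N} {w : N ≃ᵃ[ℝ] N} (h : IsMinElt b V F w)
    (hr : IsReducedExpr ([] : List (Simple b V)) w) : F ⊆ antiDominant b V := by
  obtain ⟨-, F₀, h1, rfl⟩ := sendsTo_iff.1 h.1
  have e : w '' F₀ = F₀ := by rw [← hr.1]; exact Set.image_id F₀
  rwa [e]

variable [Finite ι] [P.IsCrystallographic] [P.IsReduced]

/-- A fold at `H_j` is `s_j` itself. A fold at any other wall is conjugated by `s_j` into a fold at
a wall of a positive root, so it stays positive. -/
theorem IsPosFolding.image_or (j : Simple b V) {A B : Set N} (h : IsPosFolding b V A B) :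
    B = simpleRefl j '' A ∨ IsPosFolding b V (simpleRefl j '' A) (simpleRefl j '' B) := by
  rw [isPosFolding_iff] at h
  obtain ⟨h, hh, rfl, h1, h2⟩ := h
  by_cases e : h = j.1
  · left; rw [e]; rfl
  right
  have hv : ∀ x, val P (reflIdx P j.1 h) (simpleRefl j x) = val P h x := fun x => by
    rw [val_reflIdx, simpleRefl, affRefl_affRefl]
  rw [isPosFolding_iff]
  refine ⟨_, reflIdx_mem_walls j hh e, ?_, ?_, fun x hx => ?_⟩
  · rw [← mul_image, ← mul_image]
    congr 2
    have := affRefl_mul_affRefl_reflIdx P j.1 h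
    have e1 := affRefl_mul_self P j.1
    calc affRefl P (reflIdx P j.1 h) * simpleRefl j
        = (affRefl P j.1 * affRefl P j.1) * affRefl P (reflIdx P j.1 h) * affRefl P j.1 := by
          rw [e1, one_mul]; rfl
      _ = affRefl P j.1 * (affRefl P j.1 * affRefl P (reflIdx P j.1 h)) * affRefl P j.1 := by
          simp only [mul_assoc]
      _ = affRefl P j.1 * affRefl P h * (affRefl P j.1 * affRefl P j.1) := by
          rw [this]; simp only [mul_assoc]
      _ = simpleRefl j * affRefl P h := by rw [e1, mul_one]; rfl
  · rintro _ ⟨x, hx, rfl⟩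
    rw [hv]; exact h1 x hx
  · obtain ⟨y, hy, rfl⟩ := openFace_image_subset (simpleRefl_mem j) _ hx
    rw [hv]; exact h2 y hy

/-- The lifting property of chains of positive foldings. -/
theorem reflTransGen_image_or (j : Simple b V) {A B : Set N}
    (h : Relation.ReflTransGen (IsPosFolding b V) A B) :
    Relation.ReflTransGen (IsPosFolding b V) (simpleRefl j '' A) B ∨
      Relation.ReflTransGen (IsPosFolding b V) (simpleRefl j '' A) (simpleRefl j '' B) := by
  induction h with
  | refl => exact .inr .refl
  | @tail B C _ hBC ih =>
    rcases hBC.image_or j with rfl | h1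
    · rcases ih with ih | ih
      · exact .inl (ih.tail hBC)
      · exact .inl ih
    · rcases ih with ih | ih
      · exact .inl (ih.tail hBC)
      · exact .inr (ih.tail h1)

theorem IsMinElt.tail {F : Set N} {w : N ≃ᵃ[ℝ] N} (h : IsMinElt b V F w) {j : Simple b V}
    {L : List (Simple b V)} (hr : IsReducedExpr (j :: L) w) :
    IsMinElt b V (simpleRefl j '' F) (simpleRefl j * w) := by
  refine ⟨h.1.mul (simpleRefl_mem j), fun v hv => ?_⟩
  have h1 := h.2 _ (by simpa only [simpleRefl_image_image] using hv.mul (simpleRefl_mem j))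
  have h2 := len_simpleRefl_mul_le j hv.1
  have h3 := hr.tail.2
  lia

/-- The length condition puts `s_j(F)` on the negative side of `H_j`. If the open face of `F` met
`H_j`, then `s_j` would fix `F` and the shorter `s_j w` would still send the face of `C_V^-` to `F`.
-/
theorem IsMinElt.isPosFolding {F : Set N} {w : N ≃ᵃ[ℝ] N} (h : IsMinElt b V F w)
    {j : Simple b V} {L : List (Simple b V)} (hr : IsReducedExpr (j :: L) w) :
    IsPosFolding b V (simpleRefl j '' F) F := by
  have hlen := hr.tail.2
  have hm := mul_mem (simpleRefl_mem j) h.1.1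
  have hneg : ∀ x ∈ simpleRefl j '' F, val P j.1 x ≤ 0 := by
    obtain ⟨-, F₀, h1, rfl⟩ := sendsTo_iff.1 h.1
    rw [← mul_image]
    rintro _ ⟨x, hx, rfl⟩
    exact val_nonpos_of_len_lt j hm (h1 hx) (by rw [simpleRefl_mul_cancel]; lia)
  rw [isPosFolding_iff]
  refine ⟨j.1, j.2.1, simpleRefl_image_image j F, hneg, fun x hx => ?_⟩
  have h1 := hneg _ ⟨x, hx.1, rfl⟩
  rw [simpleRefl, val_affRefl_self] at h1
  refine lt_of_le_of_ne (by linarith) fun h0 => ?_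
  have hF := hx.2 j.1 j.2.1 h0.symm
  have e : simpleRefl j '' F = F := by
    conv_rhs => rw [← Set.image_id F]
    exact Set.image_congr fun y hy => affRefl_of_val_eq_zero P (hF hy)
  have := h.2 _ (e ▸ h.1.mul (simpleRefl_mem j))
  lia

theorem IsGallery.eq_or_eq {j : Simple b V} {i : List (Simple b V)} {C : Set N}
    {gal : List (Set N)}
    (h : IsGallery b V (j :: i) (antiDominant b V :: C :: gal)) :
    C = antiDominant b V ∨ C = simpleRefl j '' antiDominant b V := by
  obtain ⟨H, h1, h2, h3, h4⟩ := h.panel 0 (by simp)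
  exact chamber_eq_or_eq (h.chamber C (by simp)) h1 h2 h3 h4

/-- Induction on the word. After a stutter `C_1 = C_V^-`, the chain to `s_j(F)` is prolonged by the
fold to `F`. After a crossing, the chain from `s_j(F')` to `s_j(F)` is lifted to one from `F'`,
ending in `F` or in `s_j(F)`, and prolonged in the latter case. -/
theorem IsGallery.reflTransGen (hv : IsVertex b V) {i : List (Simple b V)} {gal : List (Set N)}
    (h : IsGallery b V i gal) (hd : gal.head? = some (antiDominant b V)) {F : Set N}
    {w : N ≃ᵃ[ℝ] N} (hF : IsEdge b F) (hVF : V ∈ F) (hw : IsMinElt b V F w)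
    (hr : IsReducedExpr i w) {C F' : Set N} (hC : gal.getLast? = some C) (hFC : F' ⊆ C)
    (hF' : IsEdge b F') (hVF' : V ∈ F') (ht : faceType b V F' = faceType b V F) :
    Relation.ReflTransGen (IsPosFolding b V) F' F := by
  induction i generalizing gal F w C F' with
  | nil =>
    obtain ⟨A, rfl⟩ := List.length_eq_one_iff.1 h.length_eq
    simp only [List.head?_cons, Option.some.injEq, List.getLast?_singleton] at hd hC
    rw [← hC, hd] at hFC
    rw [hF'.eq_of_faceType_eq hv hF hVF' hVF hFC (hw.subset_antiDominant hr) ht]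
  | cons j i ih =>
    obtain ⟨D, tl, rfl⟩ := h.exists_cons hd
    have hm := simpleRefl_mem j
    have hV' : ∀ {G : Set N}, V ∈ G → V ∈ simpleRefl j '' G := fun hG =>
      ⟨V, hG, weyl_vertex hm⟩
    have hfold := hw.isPosFolding hr
    have hC' : (D :: tl).getLast? = some C := by simpa using hC
    rcases h.eq_or_eq with rfl | hD
    · exact (ih h.tail rfl (hF.image hm) (hV' hVF) (hw.tail hr) hr.tail.1 hC' hFC hF' hVF'
        (by rw [faceType_image hm, ht])).tail hfold
    · have h1 := ih (h.tail.map hm) (by simp [hD, simpleRefl_image_image]) (hF.image hm)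
        (hV' hVF) (hw.tail hr) hr.tail.1 (C := simpleRefl j '' C) (F' := simpleRefl j '' F')
        (by rw [List.getLast?_map, hC']; rfl) (Set.image_mono hFC) (hF'.image hm) (hV' hVF')
        (by rw [faceType_image hm, faceType_image hm, ht])
      rcases reflTransGen_image_or j h1 with h2 | h2 <;> rw [simpleRefl_image_image] at h2
      · exact h2.tail hfold
      · rwa [simpleRefl_image_image] at h2

theorem MemGamma.isPosFolded {E F S : Set N} {i : List (Simple b V)} {c : List (Set N)}
    (h : MemGamma b V E F S i c) (h2 : IsTwoStep b V E F) : IsPosFolded b V E F := by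
  obtain ⟨w, hw, hr⟩ := h.reduced
  obtain ⟨C, F', hC, hFC, ht, hmin⟩ := h.last
  exact ⟨h2, F', hmin, h.gallery.reflTransGen h2.vertex h.head h2.edge_right h2.mem_right hw hr
    hC hFC hmin.1.edge_right hmin.1.mem_right ht⟩

/-! ### Decomposition of galleries of chambers -/

theorem MemGamma.exists_eq_f {E F S : Set N} {j : Simple b V} {i : List (Simple b V)}
    {c : List (Set N)} (h : MemGamma b V E F S (j :: i) c) (h2 : IsTwoStep b V E F) :
    ∃ p, ∃ z : TaggedGallery b V, Dom p j z ∧ z.type = i ∧ ⟨E, F, S, j :: i, c⟩ = f p j z ∧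
      faceType b V z.E = faceType b V E ∧ faceType b V z.F = faceType b V F := by
  obtain ⟨w, hw, hr⟩ := h.reduced
  obtain ⟨C, F', hC, hFC, ht, hmin⟩ := h.last
  obtain ⟨D, tl, rfl⟩ := h.gallery.exists_cons h.head
  have hm := simpleRefl_mem j
  have hVj := weyl_vertex hm
  have hC' : (D :: tl).getLast? = some C := by simpa using hC
  have hlen : faceLen b V (simpleRefl j '' (simpleRefl j '' F)) =
      faceLen b V (simpleRefl j '' F) + 1 := by
    rw [simpleRefl_image_image, faceLen_eq hw, faceLen_eq (hw.tail hr), hr.tail.2]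
  have hmap : ∀ l : List (Set N),
      (l.map fun C => simpleRefl j '' C).map (fun C => simpleRefl j '' C) = l := fun l => by
    rw [List.map_map]
    conv_rhs => rw [← List.map_id l]
    exact List.map_congr_left fun A _ => simpleRefl_image_image j A
  rcases h.gallery.eq_or_eq with rfl | hD
  · have hz : MemGamma b V E (simpleRefl j '' F) S i (antiDominant b V :: tl) :=
      ⟨h.chamber, h.subset, ⟨_, hw.tail hr, hr.tail.1⟩, h.gallery.tail, rfl, h.folded.tail,
        C, F', hC', hFC, by rw [faceType_image hm, ht], hmin⟩
    have hz2 : IsTwoStep b V E (simpleRefl j '' F) :=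
      ⟨h2.vertex, h2.edge_left, h2.mem_left, h2.edge_right.image hm, V, h2.mem_right, hVj⟩
    refine ⟨.two, ⟨E, simpleRefl j '' F, S, i, antiDominant b V :: tl⟩,
      ⟨hz.isPosFolded hz2, hz, hlen, ?_⟩, rfl, ?_, rfl, faceType_image hm F⟩
    · obtain ⟨v, hv, rfl⟩ := exists_image_antiDominant_eq h.chamber
      refine ⟨v, hv, rfl, ?_⟩
      obtain ⟨H, h3, h4, h5, k, hk, h6, h7⟩ := h.folded 0 (by simp) (by simp) rfl
      change H ⊆ antiDominant b V at h5
      change faceType b V H = {j} at h4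
      change Separates b V k _ (antiDominant b V) at h7
      -- The panel of type `j` in `C_V^-` spans `H_j`, so the separating wall is `H_j`; `S` then
      -- lies on its positive side, which is the length condition for `f_2^j`.
      obtain rfl : k = j.1 :=
        wall_eq_of_subset h3.2 hk j.2.1 h6 (IsPanel.subset_hyperplane h5 h4)
      obtain ⟨y, hy⟩ := exists_regular b V
      have hyC : y ∈ antiDominant b V := fun h hh => (hy h hh).le
      have hyo : y ∈ openFace b V (antiDominant b V) :=
        ⟨hyC, fun h hh h0 => absurd h0 (hy h hh).ne⟩
      refine len_of_val_pos j hv hyC ?_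
      rcases h7 with ⟨h8, -⟩ | ⟨-, h8⟩
      -- The image `v y` of a regular point is regular, which makes the inequality strict.
      · refine lt_of_le_of_ne (h8 ⟨y, hyC, rfl⟩) fun h0 => ?_
        obtain ⟨k, hk, e⟩ := exists_wall_image (inv_mem hv) j.2.1
        have e1 : (v⁻¹ : N ≃ᵃ[ℝ] N) (v y) = y := v.symm_apply_apply y
        have e2 : val P k y = 0 := by
          rw [← e1]
          rcases e with e | e <;> rw [e, ← h0]
          simp
        exact (hy k hk).ne e2
      · have := h8 hyo
        exact absurd this (hy _ j.2.1).not_gt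
    · simp [f, simpleRefl_image_image]
  · have hz : MemGamma b V (simpleRefl j '' E) (simpleRefl j '' F) (simpleRefl j '' S) i
        ((D :: tl).map fun C => simpleRefl j '' C) :=
      ⟨h.chamber.image hm, Set.image_mono h.subset, ⟨_, hw.tail hr, hr.tail.1⟩,
        h.gallery.tail.map hm, by simp [hD, simpleRefl_image_image], h.folded.tail.map hm,
        simpleRefl j '' C, simpleRefl j '' F', by rw [List.getLast?_map, hC']; rfl,
        Set.image_mono hFC, by rw [faceType_image hm, faceType_image hm, ht], hmin.image hm⟩
    refine ⟨.one, ⟨simpleRefl j '' E, simpleRefl j '' F, simpleRefl j '' S, i,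
      (D :: tl).map fun C => simpleRefl j '' C⟩,
      ⟨hz.isPosFolded (h2.image hm), hz, hlen, trivial⟩, rfl, ?_, faceType_image hm E,
      faceType_image hm F⟩
    simp only [f, simpleRefl_image_image, hmap]

theorem MemGamma.exists_isIterate {i : List (Simple b V)} : ∀ {E F S : Set N} {c : List (Set N)},
    MemGamma b V E F S i c → IsPosFolded b V E F → ∃ E' F' S' p,
      IsPosFolded b V E' F' ∧ faceType b V E' = faceType b V E ∧
      faceType b V F' = faceType b V F ∧ F' ⊆ antiDominant b V ∧
      MemGamma b V E' F' S' [] [antiDominant b V] ∧ p.length = i.length ∧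
      IsIterate ⟨E', F', S', [], [antiDominant b V]⟩ p i ⟨E, F, S, i, c⟩ := by
  induction i with
  | nil =>
    intro E F S c h hp
    obtain ⟨A, rfl⟩ := List.length_eq_one_iff.1 h.gallery.length_eq
    have hA := h.head
    simp only [List.head?_cons, Option.some.injEq] at hA
    subst hA
    obtain ⟨w, hw, hr⟩ := h.reduced
    exact ⟨E, F, S, [], hp, rfl, rfl, hw.subset_antiDominant hr, h, rfl, rfl⟩
  | cons j i ih =>
    intro E F S c h hp
    obtain ⟨p, ⟨zE, zF, zS, _, zc⟩, hz, rfl, hfz, hE, hF⟩ := h.exists_eq_f hp.1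
    obtain ⟨E', F', S', ps, h1, h2, h3, h4, h5, h6, h7⟩ := ih hz.2.1 hz.1
    exact ⟨E', F', S', p :: ps, h1, h2.trans hE, h3.trans hF, h4, h5, by simp [h6], _, h7, hz, hfz⟩

/-- The second chamber, `s_j(C_V^-)` or `C_V^-`, reveals which of the two maps was applied. -/
theorem f_injective {p q : Kind} {j : Simple b V} {x y : TaggedGallery b V} (hx : Dom p j x)
    (hy : Dom q j y) (h : f p j x = f q j y) : p = q ∧ x = y := by
  have hxh := hx.2.1.head
  have hyh := hy.2.1.head
  have hinj : Function.Injective fun C : Set N => simpleRefl j '' C :=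
    (simpleRefl j).injective.image_injective
  cases p <;> cases q <;> simp only [f, TaggedGallery.mk.injEq, List.cons.injEq, true_and] at h
  · exact ⟨rfl, TaggedGallery.ext (hinj h.1) (hinj h.2.1) (hinj h.2.2.1) h.2.2.2.1
      (hinj.list_map h.2.2.2.2)⟩
  · rw [← h.2.2.2.2, List.head?_map, hxh] at hyh
    exact absurd (by simpa using hyh) (antiDominant_ne j)
  · rw [h.2.2.2.2, List.head?_map, hyh] at hxh
    exact absurd (by simpa using hxh) (antiDominant_ne j)
  · exact ⟨rfl, TaggedGallery.ext h.1 (hinj h.2.1) h.2.2.1 h.2.2.2.1 h.2.2.2.2⟩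

theorem IsIterate.unique {i : List (Simple b V)} : ∀ {p q : List Kind} {x y z : TaggedGallery b V},
    IsIterate x p i z → IsIterate y q i z → p = q ∧ x = y := by
  induction i with
  | nil =>
    intro p q x y z h1 h2
    match p, q, h1, h2 with
    | [], [], h1, h2 => exact ⟨rfl, h1.symm.trans h2⟩
  | cons j i ih =>
    intro p q x y z h1 h2
    match p, q, h1, h2 with
    | a :: p, a' :: q, ⟨u, h1, hu, hz⟩, ⟨u', h2, hu', hz'⟩ =>
      obtain ⟨rfl, rfl⟩ := f_injective hu hu' (hz.symm.trans hz')
      obtain ⟨rfl, rfl⟩ := ih h1 h2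
      exact ⟨rfl, rfl⟩

end Foldings

end OneSkeleton

end

theorem theorem21 {ι M N : Type*} [Finite ι] [AddCommGroup M] [Module ℝ M] [AddCommGroup N]
    [Module ℝ N] (P : RootPairing ι ℝ M N) [P.IsCrystallographic] [P.IsReduced] (b : P.Base)
    (V : N) (E F S : Set N) (hEF : OneSkeleton.IsPosFolded b V E F)
    (i : List (OneSkeleton.Simple b V)) (c : List (Set N))
    (hc : OneSkeleton.MemGamma b V E F S i c) :
    ∃! q : Set N × Set N × Set N × List OneSkeleton.Kind,
      match q with
      | (E', F', S', p) =>
        (E', F') ∈ OneSkeleton.GammaType b V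
          (OneSkeleton.faceType b V E, OneSkeleton.faceType b V F) ∧
        F' ⊆ OneSkeleton.antiDominant b V ∧
        OneSkeleton.IsChamber b V S' ∧ E' ⊆ S' ∧
        OneSkeleton.MemGamma b V E' F' S' [] [OneSkeleton.antiDominant b V] ∧
        p.length = i.length ∧
        OneSkeleton.IsIterate ⟨E', F', S', [], [OneSkeleton.antiDominant b V]⟩ p i
          ⟨E, F, S, i, c⟩ := by
  obtain ⟨E', F', S', p, h1, h2, h3, h4, h5, h6, h7⟩ := hc.exists_isIterate hEF
  refine ⟨(E', F', S', p), ⟨⟨h1, h2, h3⟩, h4, h5.chamber, h5.subset, h5, h6, h7⟩, ?_⟩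
  rintro ⟨E'', F'', S'', p'⟩ ⟨-, -, -, -, -, -, h⟩
  obtain ⟨rfl, e⟩ := h.unique h7
  simp only [OneSkeleton.TaggedGallery.mk.injEq] at e
  obtain ⟨rfl, rfl, rfl, -, -⟩ := e
  rfl
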